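/- For $A\subset\mathbb N=\{1,2,\dots\}$ let $\mathcal M(A)$ be the set of natural numbers divisible by some $a\in A$. Every positive rational number is written as $m/n$ with coprime $m,n\in\mathbb N$. For $A,B\subset\mathbb N$ and $q\in\mathbb N$ put $$\mathcal M(A,B|q)=\Big\{\frac mn:\ m\in\mathcal M(A),\ n\in\mathcal M(B),\ \gcd(m,n)=1,\ \gcd(mn,q)=1\Big\}.$$ For each real $x\ge 1$ let $I_x=(\lambda_1,\lambda_2)=(\lambda_1(x),\lambda_2(x))\subset(0,+\infty)$ be an interval with real endpoints, $\lambda_1(x)\ge 0$, let $\mathcal F_x^I$ be the finite set of positive rationals $m/n\in I_x$ (in lowest terms) with $n\le x$, and for $R\subset\mathbb Q^+$ let $$\nu_x^{11}(R)=\Big(\sum_{m/n\in\mathcal F_x^I\cap R}\frac1{mn}\Big)\Big/\Big(\sum_{m/n\in\mathcal F_x^I}\frac1{mn}\Big)$$ whenever $\mathcal F_x^I\neq\emptyset$. **Theorem 5.** Suppose that there are constants $c_1,c_2,c_3>0$ such that: * for those $x$ with $\lambda_1(x)=0$: $\lambda_2x\to\infty$ as $x\to\infty$, and $\dfrac{\log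 x}{\log(\lambda_2x)}<c_1$ for all sufficiently large $x$; * for those $x$ with $\lambda_1(x)>0$: $\dfrac{c_2}{\log(\lambda_2+2)}<\lambda_1<\lambda_2<x^{c_3}$ for all sufficiently large $x$, and $\dfrac{1}{\log(\lambda_2+2)}\cdot\log\Big(\dfrac{\lambda_2}{\lambda_1}\Big)\cdot\log x\to\infty$ as $x\to\infty$. (In particular this covers the cases where $\lambda_1(x)=0$ for all $x$, and where $\lambda_1(x)>0$ for all $x$.) Then for arbitrary (finite or infinite) sets $A,B\subset\mathbb N$ and every $q\in\mathbb N$, the set $\mathcal F_x^I$ is non-empty for all sufficiently large $x$, and the limit $$\nu^{11}\big(\mathcal M(A,B|q)\big)=\lim_{x\to\infty}\nu_x^{11}\big(\mathcal M(A,B|q)\big)$$ exists. -/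

import Mathlib

open Filter Topology

/-- The set of (positive) multiples of the elements of `A`. Zero is not counted as a natural
number, so a possible element `0 ∈ A` contributes nothing. -/
def multiples (A : Set ℕ) : Set ℕ :=
  {m | 0 < m ∧ ∃ a ∈ A, a ∣ m}

/-- The rational multiples: positive rationals `m / n` in lowest terms with `m` a multiple of an
element of `A`, `n` a multiple of an element of `B`, and `m * n` coprime to `q`. -/
def ratMultiples (A B : Set ℕ) (q : ℕ) : Set ℚ :=
  {r | 0 < r ∧ r.num.natAbs ∈ multiples A ∧ r.den ∈ multiples B ∧
    Nat.Coprime (r.num.natAbs * r.den) q}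

/-- The positive rationals with denominator (in lowest terms) at most `x` that lie in the open
interval `(l₁, l₂)`. -/
def fareySet (x l₁ l₂ : ℝ) : Set ℚ :=
  {r | 0 < r ∧ (r.den : ℝ) ≤ x ∧ (r : ℝ) ∈ Set.Ioo l₁ l₂}

theorem fareySet_finite (x l₁ l₂ : ℝ) : (fareySet x l₁ l₂).Finite := by
  have hfin : (Set.Icc (0 : ℤ) ⌈l₂ * x⌉ ×ˢ Set.Iic ⌊x⌋₊).Finite :=
    (Set.finite_Icc _ _).prod (Set.finite_Iic _)
  refine Set.Finite.of_finite_image (f := fun r : ℚ => (r.num, r.den)) (hfin.subset ?_) ?_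
  · rintro _ ⟨r, ⟨hr0, hrx, -, hr2⟩, rfl⟩
    have hd : (0 : ℝ) < r.den := by exact_mod_cast r.den_pos
    have hr0' : (0 : ℝ) < (r : ℝ) := by exact_mod_cast hr0
    refine ⟨⟨(Rat.num_pos.mpr hr0).le, ?_⟩, Nat.le_floor hrx⟩
    have h1 : (r.num : ℝ) = (r : ℝ) * r.den := by
      exact_mod_cast (Rat.mul_den_eq_num r).symm
    have h2 : (r.num : ℝ) ≤ l₂ * x := by
      rw [h1]
      exact mul_le_mul hr2.le hrx hd.le (hr0'.trans hr2).le
    have h3 : (r.num : ℝ) ≤ (⌈l₂ * x⌉ : ℤ) := h2.trans (Int.le_ceil _)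
    exact_mod_cast h3
  · intro r _ s _ h
    simp only [Prod.mk.injEq] at h
    exact Rat.ext h.1 h.2

/-- The sum of `m ^ (-r₁) * n ^ (-r₂)` over the rationals `m / n` (in lowest terms) that lie in
`R`, in the interval `(l₁, l₂)`, and have `n ≤ x`. -/
noncomputable def weightedSum (r₁ r₂ : ℕ) (x l₁ l₂ : ℝ) (R : Set ℚ) : ℝ :=
  open Classical in
  ∑ r ∈ (fareySet_finite x l₁ l₂).toFinset with r ∈ R,
    ((r.num : ℝ) ^ r₁)⁻¹ * ((r.den : ℝ) ^ r₂)⁻¹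

/-- The proportion of `R` among the rationals of `fareySet x l₁ l₂`, with the weights
`m ^ (-r₁) * n ^ (-r₂)`; meaningful when `fareySet x l₁ l₂` is not empty. -/
noncomputable def nu (r₁ r₂ : ℕ) (x l₁ l₂ : ℝ) (R : Set ℚ) : ℝ :=
  weightedSum r₁ r₂ x l₁ l₂ R / weightedSum r₁ r₂ x l₁ l₂ (fareySet x l₁ l₂)

/-! Pass from reduced fractions to pairs `(m, n)` in the strip `n ≤ x`, `λ₁ n < m < λ₂ n`, each
weighted by `1 / (m n)`. The proportion is then a quotient of two masses of pairs, both with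
coprimality imposed, and it suffices to show that each, divided by the mass of the whole strip,
converges.

Truncate the conditions at `T`: keep only `a ≤ T` in `A` and `B`, and only common divisors `d ≤ T`
in the coprimality. The truncated condition is periodic modulo `q * T!`. Moving one residue class to
another inside a row or a column costs at most its largest term, and the sum of these costs is
negligible against the total mass, so a periodic condition has the expected density
(`abs_mass_periodic_sub_le`).

Two truncation errors remain. Common divisors `d > T` have relative mass at most `∑ d⁻²` over `d >
T`, since dividing by `d` maps the strip into itself (`mass_common_divisor_le`). Multiples of `A`
that are not multiples of its elements up to `T` have small upper logarithmic density, by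
Davenport–Erdős (`exists_logSum_multiples_diff_le`); the weight `1 / (m n)` is logarithmic in each
variable, so such integers have small relative mass as well.

Thus the relative mass is eventually within any `ε` of a constant, and so converges. What is needed
of the intervals is collected in `RegularStrips`, which holds in both regimes `λ₁ = 0` and `λ₁ > 0`.
The approximating constants do not involve the interval, so the regimes may alternate as `x` grows.
-/

section
open scoped Classical

/-! ### Harmonic sums over intervals of integers. -/

/-- Telescoping lower bound for harmonic sums. -/
theorem log_div_le_sum_Ico_inv {p q : ℕ} (hp : 0 < p) (hq : 0 < q) :
    Real.log (q / p) ≤ ∑ m ∈ Finset.Ico p q, (m : ℝ)⁻¹ := by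
  rcases le_total q p with h | h
  · rw [Finset.Ico_eq_empty (by omega), Finset.sum_empty]
    apply Real.log_nonpos (by positivity)
    rw [div_le_one (by positivity)]
    exact_mod_cast h
  · induction q, h using Nat.le_induction with
    | base => simp [div_self (show (p : ℝ) ≠ 0 by positivity)]
    | succ n hn ih =>
      have hn0 : 0 < n := by omega
      rw [Finset.sum_Ico_succ_top hn]
      have := ih hn0
      have h1 : Real.log (((n + 1 : ℕ) : ℝ) / p) = Real.log (n / p) + Real.log ((n + 1 : ℕ) / n) := by
        rw [← Real.log_mul (by positivity) (by positivity)]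
        congr 1
        field_simp
      have h2 : Real.log (((n + 1 : ℕ) : ℝ) / n) ≤ (n : ℝ)⁻¹ := by
        refine (Real.log_le_sub_one_of_pos (by positivity)).trans (le_of_eq ?_)
        push_cast
        field_simp
        ring
      linarith

/-- Telescoping upper bound for harmonic sums. -/
theorem sum_Ioc_inv_le_log_div {p q : ℕ} (hp : 0 < p) (h : p ≤ q) :
    ∑ m ∈ Finset.Ioc p q, (m : ℝ)⁻¹ ≤ Real.log (q / p) := by
  induction q, h using Nat.le_induction with
  | base => simp [div_self (show (p : ℝ) ≠ 0 by positivity)]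
  | succ n hn ih =>
    have hn0 : 0 < n := by omega
    rw [Finset.sum_Ioc_succ_top hn]
    have h1 : Real.log (((n + 1 : ℕ) : ℝ) / p) = Real.log (n / p) + Real.log ((n + 1 : ℕ) / n) := by
      rw [← Real.log_mul (by positivity) (by positivity)]
      congr 1
      field_simp
    have h2 : ((n + 1 : ℕ) : ℝ)⁻¹ ≤ Real.log (((n + 1 : ℕ) : ℝ) / n) := by
      refine le_trans (le_of_eq ?_)
        (Real.one_sub_inv_le_log_of_pos (x := ((n + 1 : ℕ) : ℝ) / n) (by positivity))
      push_cast
      field_simp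
      ring
    linarith

theorem sum_Icc_inv_le_one_add_log {y : ℝ} (hy : 1 ≤ y) :
    ∑ m ∈ Finset.Icc 1 ⌊y⌋₊, (m : ℝ)⁻¹ ≤ 1 + Real.log y := by
  have h1 : 1 ≤ ⌊y⌋₊ := Nat.le_floor (by simpa using hy)
  have h2 := sum_Ioc_inv_le_log_div one_pos h1
  have h3 : Finset.Icc 1 ⌊y⌋₊ = insert 1 (Finset.Ioc 1 ⌊y⌋₊) := (Finset.Ioc_insert_left h1).symm
  rw [h3, Finset.sum_insert (by simp)]
  have h4 : Real.log ((⌊y⌋₊ : ℝ) / (1 : ℕ)) ≤ Real.log y := by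
    apply Real.log_le_log (by simp; omega)
    simpa using Nat.floor_le (by linarith)
  push_cast at *
  linarith

theorem sum_Ioc_inv_sq_le (k n : ℕ) :
    ∑ m ∈ Finset.Ioc k n, ((m : ℝ) ^ 2)⁻¹ ≤ 2 / (k + 1) := by
  have h := sum_Ioo_inv_sq_le (α := ℝ) k (n + 1)
  rwa [Finset.Ioo_add_one_right_eq_Ioc] at h

/-- Harmonic sums over the integers of an interval `(u, v)`: upper bound. -/
theorem sum_inv_le_log_div_add {J : Finset ℕ} {u v : ℝ} (hu : 0 < u) (huv : u < v)
    (hJ : ∀ m ∈ J, 1 ≤ m ∧ u < m ∧ (m : ℝ) < v) :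
    ∑ m ∈ J, (m : ℝ)⁻¹ ≤ Real.log (v / u) + (max 1 u)⁻¹ := by
  have hlog : 0 ≤ Real.log (v / u) := Real.log_nonneg (by rw [le_div_iff₀ hu]; linarith)
  rcases J.eq_empty_or_nonempty with rfl | hne
  · simp only [Finset.sum_empty]; positivity
  set p := J.min' hne
  set q := J.max' hne
  have hp := hJ p (J.min'_mem hne)
  have hq := hJ q (J.max'_mem hne)
  have hpq : p ≤ q := J.min'_le _ (J.max'_mem hne)
  have hsub : J ⊆ insert p (Finset.Ioc p q) := by
    intro m hm
    rw [Finset.Ioc_insert_left hpq]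
    exact Finset.mem_Icc.2 ⟨J.min'_le _ hm, J.le_max' _ hm⟩
  calc ∑ m ∈ J, (m : ℝ)⁻¹ ≤ ∑ m ∈ insert p (Finset.Ioc p q), (m : ℝ)⁻¹ :=
        Finset.sum_le_sum_of_subset_of_nonneg hsub (fun _ _ _ => by positivity)
    _ = (p : ℝ)⁻¹ + ∑ m ∈ Finset.Ioc p q, (m : ℝ)⁻¹ := Finset.sum_insert (by simp)
    _ ≤ (max 1 u)⁻¹ + Real.log (v / u) := by
        apply add_le_add
        · apply inv_anti₀ (by positivity)
          exact max_le (by exact_mod_cast hp.1) hp.2.1.le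
        · refine (sum_Ioc_inv_le_log_div (by omega) hpq).trans ?_
          have hp0 : (0 : ℝ) < p := by exact_mod_cast hp.1
          apply Real.log_le_log (div_pos (by exact_mod_cast hq.1) hp0)
          exact div_le_div₀ (by linarith) hq.2.2.le hu hp.2.1.le
    _ = _ := add_comm _ _

/-- Harmonic sums over the integers of an interval `(u, v)`: lower bound. -/
theorem log_div_sub_le_sum_inv {M : ℕ} {u v : ℝ} (hu : 0 < u) (hv : 0 < v) (hM : v ≤ M + 1) :
    Real.log (v / u) - u⁻¹ ≤
      ∑ m ∈ Finset.Icc 1 M with (u < (m : ℕ) ∧ ((m : ℕ) : ℝ) < v), (m : ℝ)⁻¹ := by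
  set p := ⌊u⌋₊ + 1
  have hp : (p : ℝ) ≤ u + 1 := by
    have := Nat.floor_le hu.le
    push_cast [p]
    linarith
  have hp' : u < p := by exact_mod_cast Nat.lt_floor_add_one u
  have hp0 : (0 : ℝ) < p := by linarith
  have hsub : Finset.Ico p ⌈v⌉₊ ⊆
      {m ∈ Finset.Icc 1 M | u < (m : ℕ) ∧ ((m : ℕ) : ℝ) < v} := by
    intro m hm
    rw [Finset.mem_Ico, Nat.lt_ceil] at hm
    have h1 : (m : ℝ) < M + 1 := by linarith [hm.2]
    have h2 : m < M + 1 := by exact_mod_cast h1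
    have h3 : (p : ℝ) ≤ m := by exact_mod_cast hm.1
    simp only [Finset.mem_filter, Finset.mem_Icc]
    exact ⟨⟨by omega, by omega⟩, by linarith, hm.2⟩
  refine le_trans ?_ (Finset.sum_le_sum_of_subset_of_nonneg hsub (fun _ _ _ => by positivity))
  refine le_trans ?_ (log_div_le_sum_Ico_inv (by omega) (Nat.ceil_pos.2 hv))
  have h1 : Real.log (v / p) ≤ Real.log ((⌈v⌉₊ : ℝ) / p) := by
    apply Real.log_le_log (by positivity)
    gcongr
    exact Nat.le_ceil v
  have h2 : Real.log (v / u) = Real.log (v / p) + Real.log (p / u) := by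
    rw [← Real.log_mul (by positivity) (by positivity)]
    congr 1
    field_simp
  have h3 : Real.log (p / u) ≤ u⁻¹ := by
    refine (Real.log_le_sub_one_of_pos (by positivity)).trans ?_
    rw [div_sub_one hu.ne', div_eq_mul_inv]
    have : 0 < u⁻¹ := by positivity
    nlinarith
  linarith

theorem log_le_sum_inv {M : ℕ} {v : ℝ} (hv : 0 < v) (hM : v ≤ M + 1) :
    Real.log v ≤ ∑ m ∈ Finset.Icc 1 M with ((m : ℕ) : ℝ) < v, (m : ℝ)⁻¹ := by
  have hsub : Finset.Ico 1 ⌈v⌉₊ ⊆ {m ∈ Finset.Icc 1 M | ((m : ℕ) : ℝ) < v} := by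
    intro m hm
    rw [Finset.mem_Ico, Nat.lt_ceil] at hm
    have h1 : (m : ℝ) < M + 1 := by linarith [hm.2]
    have h2 : m < M + 1 := by exact_mod_cast h1
    simp only [Finset.mem_filter, Finset.mem_Icc]
    exact ⟨⟨by omega, by omega⟩, hm.2⟩
  refine le_trans ?_ (Finset.sum_le_sum_of_subset_of_nonneg hsub (fun _ _ _ => by positivity))
  refine le_trans ?_ (log_div_le_sum_Ico_inv one_pos (Nat.ceil_pos.2 hv))
  apply Real.log_le_log hv
  simpa using Nat.le_ceil v

/-- On an interval of integers, the harmonic sums over two residue classes differ by at most the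
largest term. -/
theorem sum_inv_residue_le {N : ℕ} [NeZero N] {J : Finset ℕ} {c : ℝ} (hc : 0 < c)
    (hJ : ∀ m ∈ J, c ≤ m) (hconn : ∀ m ∈ J, ∀ n ∈ J, ∀ k, m ≤ k → k ≤ n → k ∈ J) (i j : ZMod N) :
    ∑ m ∈ J with ((m : ℕ) : ZMod N) = i, (m : ℝ)⁻¹ ≤
      (∑ m ∈ J with ((m : ℕ) : ZMod N) = j, (m : ℝ)⁻¹) + c⁻¹ := by
  rcases J.eq_empty_or_nonempty with rfl | hne
  · simp only [Finset.filter_empty, Finset.sum_empty]; positivity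
  set p := J.min' hne
  have hpJ : p ∈ J := J.min'_mem hne
  set t := (i - j).val
  have ht : t < N := ZMod.val_lt _
  -- Terms `m ≥ p + N` are shifted down by `t < N` into the class `j`; they stay in `J` and their
  -- reciprocals grow. The window `[p, p + N)` holds at most one element of the class `i`, which
  -- costs `c⁻¹`.
  rw [← Finset.sum_filter_add_sum_filter_not (Finset.filter _ J) (fun m => p + N ≤ m)]
  apply add_le_add
  · have hinj : Set.InjOn (fun m : ℕ => m - t)
        (({m ∈ {m ∈ J | ((m : ℕ) : ZMod N) = i} | p + N ≤ m} : Finset ℕ) : Set ℕ) := by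
      intro m hm n hn h
      simp only [Finset.coe_filter, Finset.mem_filter, Set.mem_ofPred_eq] at hm hn h
      omega
    calc _ ≤ ∑ m ∈ {m ∈ {m ∈ J | ((m : ℕ) : ZMod N) = i} | p + N ≤ m}, ((m - t : ℕ) : ℝ)⁻¹ := by
          apply Finset.sum_le_sum
          intro m hm
          simp only [Finset.mem_filter] at hm
          have h1 : m - t ∈ J := hconn p hpJ m hm.1.1 _ (by omega) (by omega)
          have h2 := hJ _ h1
          apply inv_anti₀ (by linarith)
          exact_mod_cast Nat.sub_le m t
      _ = ∑ m ∈ Finset.image (fun m : ℕ => m - t)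
            {m ∈ {m ∈ J | ((m : ℕ) : ZMod N) = i} | p + N ≤ m}, (m : ℝ)⁻¹ :=
          (Finset.sum_image (f := fun k : ℕ => (k : ℝ)⁻¹) hinj).symm
      _ ≤ _ := by
          apply Finset.sum_le_sum_of_subset_of_nonneg _ (fun _ _ _ => by positivity)
          intro k hk
          simp only [Finset.mem_image, Finset.mem_filter] at hk ⊢
          obtain ⟨m, ⟨⟨hm, hmi⟩, hpm⟩, rfl⟩ := hk
          refine ⟨hconn p hpJ m hm _ (by omega) (by omega), ?_⟩
          rw [Nat.cast_sub (by omega), hmi, ZMod.natCast_zmod_val]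
          ring
  · have hcard : ({m ∈ {m ∈ J | ((m : ℕ) : ZMod N) = i} | ¬ p + N ≤ m} : Finset ℕ).card ≤ 1 := by
      rw [Finset.card_le_one]
      intro m hm n hn
      simp only [Finset.mem_filter] at hm hn
      have h1 : (m : ZMod N) = n := hm.1.2.trans hn.1.2.symm
      rw [ZMod.natCast_eq_natCast_iff] at h1
      have hm' : p ≤ m := J.min'_le _ hm.1.1
      have hn' : p ≤ n := J.min'_le _ hn.1.1
      rcases le_total m n with h | h
      · have h2 := (Nat.modEq_iff_dvd' h).1 h1
        have := Nat.eq_zero_of_dvd_of_lt h2 (by omega)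
        omega
      · have h2 := (Nat.modEq_iff_dvd' h).1 h1.symm
        have := Nat.eq_zero_of_dvd_of_lt h2 (by omega)
        omega
    calc _ ≤ ∑ m ∈ {m ∈ {m ∈ J | ((m : ℕ) : ZMod N) = i} | ¬ p + N ≤ m}, c⁻¹ := by
          apply Finset.sum_le_sum
          intro m hm
          simp only [Finset.mem_filter] at hm
          exact inv_anti₀ hc (hJ _ hm.1.1)
      _ ≤ 1 * c⁻¹ := by
          rw [Finset.sum_const, nsmul_eq_mul]
          gcongr
          exact_mod_cast hcard
      _ = c⁻¹ := one_mul _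

end

/-! ### The zeta distribution and the Davenport–Erdős theorem. -/

section

open ArithmeticFunction ArithmeticFunction.Moebius ArithmeticFunction.zeta in
/-- The power function `n ^ η` is the divisor sum of a nonnegative function (Jordan's totient). -/
theorem exists_nonneg_sum_divisors_eq_rpow {η : ℝ} (hη : 0 ≤ η) :
    ∃ J : ℕ → ℝ, (∀ n, 0 ≤ J n) ∧ ∀ n : ℕ, 0 < n → ∑ d ∈ n.divisors, J d = (n : ℝ) ^ η := by
  let g : ArithmeticFunction ℝ := ⟨fun n => if n = 0 then 0 else (n : ℝ) ^ η, by simp⟩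
  have hg : g.IsMultiplicative := by
    rw [IsMultiplicative.iff_ne_zero]
    refine ⟨by simp [g], fun {m n} hm hn _ => ?_⟩
    simp [g, hm, hn, Real.mul_rpow]
  let J : ArithmeticFunction ℝ := (μ : ArithmeticFunction ℝ) * g
  have hJ : J.IsMultiplicative := isMultiplicative_moebius.intCast.mul hg
  have hsum : ∀ n : ℕ, 0 < n → ∑ d ∈ n.divisors, J d = (n : ℝ) ^ η := by
    intro n hn
    rw [← coe_zeta_mul_apply]
    have : (ζ : ArithmeticFunction ℝ) * J = g := by
      simp only [J]
      rw [← mul_assoc, coe_zeta_mul_coe_moebius, one_mul]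
    rw [this]
    simp [g, hn.ne']
  refine ⟨J, fun n => ?_, hsum⟩
  rcases eq_or_ne n 0 with rfl | hn
  · simp
  rw [hJ.multiplicative_factorization J hn]
  refine Finset.prod_nonneg fun p hp => ?_
  have hpp : p.Prime := Nat.prime_of_mem_primeFactors hp
  have hk : n.factorization p ≠ 0 := Finsupp.mem_support_iff.1 hp
  obtain ⟨k, hk⟩ := Nat.exists_eq_succ_of_ne_zero hk
  rw [hk]
  -- By multiplicativity only prime powers matter, where `J` is the difference of consecutive values
  -- of an increasing power function.
  have h1 := hsum (p ^ (k + 1)) (pow_pos hpp.pos _)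
  have h2 := hsum (p ^ k) (pow_pos hpp.pos _)
  rw [Nat.sum_divisors_prime_pow hpp] at h1 h2
  rw [Finset.sum_range_succ, h2] at h1
  have h3 : ((p ^ k : ℕ) : ℝ) ^ η ≤ ((p ^ (k + 1) : ℕ) : ℝ) ^ η := by
    apply Real.rpow_le_rpow (by positivity) _ hη
    exact_mod_cast Nat.pow_le_pow_right hpp.pos (Nat.le_succ k)
  show 0 ≤ J (p ^ (k + 1))
  linarith

/-- The weight `n ^ (-s)` on the positive integers, in `ℝ≥0∞`. -/
noncomputable def zetaWeight (s : ℝ) (n : ℕ+) : ENNReal := ENNReal.ofReal ((n : ℝ) ^ (-s))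

open scoped Classical in
/-- The part of the zeta sum supported on `U`. -/
noncomputable def zetaSum (s : ℝ) (U : Set ℕ+) : ENNReal :=
  ∑' n : ℕ+, if n ∈ U then zetaWeight s n else 0

-- A coupling argument. Writing `n ^ (s₀ - s)` as a divisor sum of `J ≥ 0` factors the weight `n ^
-- (-s)` as the Dirichlet convolution of `a ^ (-s₀)` with the nonnegative `k b = b ^ (-s₀) * J b`.
-- So a random integer of parameter `s` is a multiple of one of parameter `s₀`, and a set closed
-- under multiples can only gain probability.
open scoped Classical in
theorem zetaSum_mul_le {s s₀ : ℝ} (hs : s ≤ s₀) {U : Set ℕ+}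
    (hU : ∀ a ∈ U, ∀ b, a * b ∈ U) :
    zetaSum s₀ U * zetaSum s Set.univ ≤ zetaSum s U * zetaSum s₀ Set.univ := by
  obtain ⟨J, hJ0, hJ⟩ := exists_nonneg_sum_divisors_eq_rpow (sub_nonneg.2 hs)
  let k : ℕ+ → ENNReal := fun b => ENNReal.ofReal ((b : ℝ) ^ (-s₀) * J b)
  have key : ∀ n : ℕ+, zetaWeight s n = ∑' x : Nat.divisorsAntidiagonal n,
      zetaWeight s₀ (divisorsAntidiagonalFactors n x).1 *
        k (divisorsAntidiagonalFactors n x).2 := by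
    intro n
    have h1 : ∀ x : Nat.divisorsAntidiagonal n,
        zetaWeight s₀ (divisorsAntidiagonalFactors n x).1 * k (divisorsAntidiagonalFactors n x).2
          = ENNReal.ofReal ((n : ℝ) ^ (-s₀) * J (x.1.2)) := by
      intro x
      have h2 := divisorsAntidiagonalFactors_eq x
      have h3 : (n : ℝ) = ((divisorsAntidiagonalFactors n x).1 : ℝ) *
          ((divisorsAntidiagonalFactors n x).2 : ℝ) := by
        rw [← Nat.cast_mul]
        exact congrArg Nat.cast h2.symm
      simp only [zetaWeight, k]
      rw [← ENNReal.ofReal_mul (by positivity), h3, Real.mul_rpow (by positivity) (by positivity)]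
      congr 1
      rw [mul_assoc]
      rfl
    simp_rw [h1]
    rw [tsum_fintype, ← ENNReal.ofReal_sum_of_nonneg
      (fun i _ => mul_nonneg (by positivity) (hJ0 _)), zetaWeight]
    congr 1
    rw [← Finset.mul_sum]
    have h4 : ∑ i : Nat.divisorsAntidiagonal n, J (i.1.2) = (n : ℝ) ^ (s₀ - s) := by
      rw [← hJ n n.pos, ← Nat.sum_divisorsAntidiagonal' (f := fun _ i => J i)]
      exact Finset.sum_coe_sort (n : ℕ).divisorsAntidiagonal (fun i => J i.2)
    rw [h4, ← Real.rpow_add (by exact_mod_cast n.pos)]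
    congr 1
    ring
  have hprod : ∀ V : Set ℕ+, zetaSum s V =
      ∑' p : ℕ+ × ℕ+, if p.1 * p.2 ∈ V then zetaWeight s₀ p.1 * k p.2 else 0 := by
    intro V
    rw [← sigmaAntidiagonalEquivProd.tsum_eq, ENNReal.tsum_sigma', zetaSum]
    congr 1
    ext n
    have h5 : ∀ x : Nat.divisorsAntidiagonal n,
        (sigmaAntidiagonalEquivProd ⟨n, x⟩).1 * (sigmaAntidiagonalEquivProd ⟨n, x⟩).2 = n := by
      intro x
      exact PNat.coe_injective (divisorsAntidiagonalFactors_eq x)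
    simp_rw [h5]
    by_cases hn : n ∈ V
    · simp only [hn, if_true]
      exact key n
    · simp [hn]
  have hmul : ∀ V : Set ℕ+, zetaSum s₀ V * ∑' b, k b =
      ∑' p : ℕ+ × ℕ+, if p.1 ∈ V then zetaWeight s₀ p.1 * k p.2 else 0 := by
    intro V
    rw [ENNReal.tsum_prod', zetaSum, ← ENNReal.tsum_mul_right]
    congr 1
    ext a
    by_cases ha : a ∈ V
    · simp [ha, ENNReal.tsum_mul_left]
    · simp [ha]
  have htot : zetaSum s Set.univ = zetaSum s₀ Set.univ * ∑' b, k b := by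
    rw [hprod, hmul]
    simp
  have hle : zetaSum s₀ U * ∑' b, k b ≤ zetaSum s U := by
    rw [hprod, hmul]
    refine ENNReal.tsum_le_tsum fun p => ?_
    by_cases hp : p.1 ∈ U
    · simp [hp, hU _ hp]
    · simp [hp]
  rw [htot, mul_left_comm, mul_comm (zetaSum s₀ Set.univ)]
  gcongr

theorem zetaSum_univ_le {s : ℝ} (hs : 1 < s) :
    zetaSum s Set.univ ≤ ENNReal.ofReal (1 + 1 / (s - 1)) := by
  have h1 := ZetaAsymptotics.zeta_limit_aux1 hs
  have h2 : 0 ≤ ZetaAsymptotics.termTSum s := tsum_nonneg fun n => ZetaAsymptotics.term_nonneg _ _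
  have h3 : (∑' n : ℕ, 1 / (n + 1 : ℝ) ^ s) ≤ 1 + 1 / (s - 1) := by nlinarith
  have h4 : Summable fun n : ℕ => 1 / (n + 1 : ℝ) ^ s := by
    have := (summable_nat_add_iff 1).2 (Real.summable_one_div_nat_rpow.2 hs)
    exact_mod_cast this
  have h5 : zetaSum s Set.univ = ENNReal.ofReal (∑' n : ℕ, 1 / (n + 1 : ℝ) ^ s) := by
    rw [ENNReal.ofReal_tsum_of_nonneg (fun n => by positivity) h4]
    simp only [zetaSum, Set.mem_univ, if_true]
    rw [← Equiv.pnatEquivNat.symm.tsum_eq]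
    congr 1
    ext n
    rw [zetaWeight, Real.rpow_neg (by positivity), one_div]
    simp
  rw [h5]
  exact ENNReal.ofReal_le_ofReal h3

theorem zetaSum_univ_ne_top {s : ℝ} (hs : 1 < s) : zetaSum s Set.univ ≠ ⊤ :=
  ne_top_of_le_ne_top ENNReal.ofReal_ne_top (zetaSum_univ_le hs)

theorem zetaSum_mono {s : ℝ} {U V : Set ℕ+} (h : U ⊆ V) : zetaSum s U ≤ zetaSum s V := by
  refine ENNReal.tsum_le_tsum fun n => ?_
  by_cases hn : n ∈ U
  · simp [hn, h hn]
  · simp [hn]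

theorem zetaSum_univ_ne_zero (s : ℝ) : zetaSum s Set.univ ≠ 0 := by
  have h := ENNReal.le_tsum (f := fun n : ℕ+ => zetaWeight s n) 1
  have h1 : zetaWeight s 1 = 1 := by simp [zetaWeight]
  rw [h1] at h
  simp only [zetaSum, Set.mem_univ, if_true]
  intro h0
  rw [h0] at h
  simp at h

theorem zetaSum_diff_add {s : ℝ} {U V : Set ℕ+} (h : U ⊆ V) :
    zetaSum s (V \ U) + zetaSum s U = zetaSum s V := by
  classical
  rw [zetaSum, zetaSum, zetaSum, ← ENNReal.tsum_add]
  congr 1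
  ext n
  by_cases hU : n ∈ U
  · simp [hU, h hU]
  · simp [hU]

/-- The probability of `U` under the zeta distribution with parameter `s`. -/
noncomputable def zetaProb (s : ℝ) (U : Set ℕ+) : ℝ := (zetaSum s U / zetaSum s Set.univ).toReal

theorem zetaProb_nonneg (s : ℝ) (U : Set ℕ+) : 0 ≤ zetaProb s U := ENNReal.toReal_nonneg

theorem zetaSum_div_le_one {s : ℝ} {U : Set ℕ+} : zetaSum s U / zetaSum s Set.univ ≤ 1 :=
  (ENNReal.div_le_div_right (zetaSum_mono (Set.subset_univ _)) _).trans ENNReal.div_self_le_one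

theorem zetaProb_le_one {s : ℝ} {U : Set ℕ+} : zetaProb s U ≤ 1 :=
  ENNReal.toReal_le_of_le_ofReal zero_le_one (by simpa using zetaSum_div_le_one)

theorem zetaProb_mono {s : ℝ} {U V : Set ℕ+} (h : U ⊆ V) : zetaProb s U ≤ zetaProb s V :=
  ENNReal.toReal_mono (ne_top_of_le_ne_top ENNReal.one_ne_top zetaSum_div_le_one)
    (ENNReal.div_le_div_right (zetaSum_mono h) _)

theorem zetaProb_diff {s : ℝ} {U V : Set ℕ+} (h : U ⊆ V) :
    zetaProb s (V \ U) = zetaProb s V - zetaProb s U := by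
  have h1 : ∀ W : Set ℕ+, zetaSum s W / zetaSum s Set.univ ≠ ⊤ := fun W =>
    ne_top_of_le_ne_top ENNReal.one_ne_top zetaSum_div_le_one
  rw [eq_sub_iff_add_eq, zetaProb, zetaProb, zetaProb, ← ENNReal.toReal_add (h1 _) (h1 _),
    ← ENNReal.add_div, zetaSum_diff_add h]

/-- The zeta probability of a set of multiples increases as the parameter decreases. -/
theorem zetaProb_anti {s s₀ : ℝ} (hs₁ : 1 < s) (hs : s ≤ s₀) {U : Set ℕ+}
    (hU : ∀ a ∈ U, ∀ b, a * b ∈ U) : zetaProb s₀ U ≤ zetaProb s U := by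
  refine ENNReal.toReal_mono (ne_top_of_le_ne_top ENNReal.one_ne_top zetaSum_div_le_one) ?_
  rw [ENNReal.div_le_iff (zetaSum_univ_ne_zero _) (zetaSum_univ_ne_top (hs₁.trans_le hs)),
    ← ENNReal.mul_div_right_comm, ENNReal.le_div_iff_mul_le
      (Or.inl (zetaSum_univ_ne_zero _)) (Or.inl (zetaSum_univ_ne_top hs₁))]
  exact zetaSum_mul_le hs hU

theorem exists_zetaProb_gt_lt {s ε : ℝ} (hs : 1 < s) (hε : 0 < ε) :
    ∃ T : ℕ, zetaProb s {n | T < (n : ℕ)} < ε := by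
  have h := ENNReal.tendsto_tsum_compl_atTop_zero (f := zetaWeight s)
    (by simpa [zetaSum] using zetaSum_univ_ne_top hs)
  have hZ := zetaSum_univ_ne_zero s
  have hpos : 0 < ENNReal.ofReal ε * zetaSum s Set.univ :=
    ENNReal.mul_pos (by simpa using hε) hZ
  obtain ⟨F, hF⟩ := (h.eventually_lt_const hpos).exists
  obtain ⟨T, hT⟩ := (F.image (fun n : ℕ+ => (n : ℕ))).bddAbove
  refine ⟨T, ?_⟩
  have h1 : zetaSum s {n | T < (n : ℕ)} ≤ ∑' b : {x // x ∉ F}, zetaWeight s b := by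
    have h2 : ∑' b : {x // x ∉ F}, zetaWeight s b =
        ∑' n, Set.indicator {x | x ∉ F} (zetaWeight s) n := tsum_subtype {x | x ∉ F} (zetaWeight s)
    rw [h2]
    refine ENNReal.tsum_le_tsum fun n => ?_
    by_cases hn : T < (n : ℕ)
    · have : n ∉ F := by
        intro hnF
        have := hT (Finset.mem_coe.2 (Finset.mem_image_of_mem _ hnF))
        omega
      simp [hn, this]
    · simp [hn]
  have h3 : zetaSum s {n | T < (n : ℕ)} / zetaSum s Set.univ < ENNReal.ofReal ε :=
    ENNReal.div_lt_of_lt_mul (h1.trans_lt hF)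
  rw [zetaProb]
  exact (ENNReal.lt_ofReal_iff_toReal_lt (ne_top_of_lt h3)).1 h3

theorem multiples_mono {A B : Set ℕ} (h : A ⊆ B) : multiples A ⊆ multiples B :=
  fun _ ⟨h0, a, ha, hd⟩ => ⟨h0, a, h ha, hd⟩

/-- **Davenport–Erdős**: the zeta probability of the multiples of `A` that are not multiples of
the small elements of `A` is uniformly small. -/
theorem exists_zetaProb_multiples_diff_lt (A : Set ℕ) {ε : ℝ} (hε : 0 < ε) :
    ∃ T : ℕ, ∃ s₀ > 1, ∀ s, 1 < s → s ≤ s₀ →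
      zetaProb s {n | (n : ℕ) ∈ multiples A ∧ (n : ℕ) ∉ multiples (A ∩ Set.Iic T)} < ε := by
  let U : Set ℕ → Set ℕ+ := fun B => {n | (n : ℕ) ∈ multiples B}
  have hUup : ∀ B, ∀ a ∈ U B, ∀ b, a * b ∈ U B := by
    rintro B a ⟨_, c, hc, hd⟩ b
    exact ⟨(a * b).pos, c, hc, by rw [PNat.mul_coe]; exact hd.mul_right _⟩
  let S : Set ℝ := (fun s => zetaProb s (U A)) '' Set.Ioi 1
  have hS : BddAbove S := ⟨1, by rintro _ ⟨s, _, rfl⟩; exact zetaProb_le_one⟩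
  have hne : S.Nonempty := ⟨_, 2, by norm_num, rfl⟩
  -- At `s₀` the probability of `U A` is within `ε / 2` of its supremum, so it gains less than `ε /
  -- 2` as `s` decreases to `1`, while the truncated set loses nothing. At `s₀` itself the two sets
  -- differ only above `T`, because a divisor of `n ≤ T` is at most `T`.
  obtain ⟨_, ⟨s₀, hs₀, rfl⟩, hlt⟩ := exists_lt_of_lt_csSup hne (sub_lt_self (sSup S) (half_pos hε))
  obtain ⟨T, hT⟩ := exists_zetaProb_gt_lt hs₀ (half_pos hε)
  refine ⟨T, s₀, hs₀, fun s hs hss => ?_⟩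
  have hsub : U (A ∩ Set.Iic T) ⊆ U A := fun n hn => multiples_mono Set.inter_subset_left hn
  have h1 : zetaProb s₀ (U A \ U (A ∩ Set.Iic T)) < ε / 2 := by
    refine (zetaProb_mono ?_).trans_lt hT
    rintro n ⟨⟨h0, a, ha, hd⟩, hn⟩
    by_contra hnT
    simp only [Set.mem_ofPred_eq, not_lt] at hnT
    exact hn ⟨h0, a, ⟨ha, (Nat.le_of_dvd h0 hd).trans hnT⟩, hd⟩
  have h2 : zetaProb s (U A) ≤ sSup S := le_csSup hS ⟨s, hs, rfl⟩
  have h3 := zetaProb_anti hs hss (hUup (A ∩ Set.Iic T))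
  rw [zetaProb_diff hsub] at h1
  have h4 : zetaProb s (U A \ U (A ∩ Set.Iic T)) < ε := by
    rw [zetaProb_diff hsub]
    dsimp only at hlt
    linarith
  exact h4

open scoped Classical in
/-- The sum of the reciprocals of the elements of `E` up to `y`. -/
noncomputable def logSum (E : Set ℕ) (y : ℝ) : ℝ :=
  ∑ m ∈ Finset.Icc 1 ⌊y⌋₊ with m ∈ E, (m : ℝ)⁻¹

-- With `s = 1 + 1 / log y`, passing from `m⁻¹` to `m ^ (-s)` for `m ≤ y` loses at most a factor
-- `e`, and the normalising zeta sum is at most `1 + 1 / (s - 1) = 1 + log y`.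
open scoped Classical in
theorem logSum_le_zetaProb (E : Set ℕ) {y : ℝ} (hy : 1 < y) :
    logSum E y ≤ Real.exp 1 * (1 + Real.log y) *
      zetaProb (1 + 1 / Real.log y) {n | (n : ℕ) ∈ E} := by
  have hL : 0 < Real.log y := Real.log_pos hy
  set s := 1 + 1 / Real.log y
  have hs : 1 < s := by
    have : 0 < 1 / Real.log y := by positivity
    simp only [s]; linarith
  set F : Finset ℕ := {m ∈ Finset.Icc 1 ⌊y⌋₊ | m ∈ E}
  have hF : ∀ m ∈ F, 0 < m ∧ (m : ℝ) ≤ y ∧ m ∈ E := by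
    intro m hm
    simp only [F, Finset.mem_filter, Finset.mem_Icc] at hm
    exact ⟨hm.1.1, (Nat.le_floor_iff (by linarith)).1 hm.1.2, hm.2⟩
  have h1 : logSum E y ≤ Real.exp 1 * ∑ m ∈ F, (m : ℝ) ^ (-s) := by
    rw [logSum, Finset.mul_sum]
    refine Finset.sum_le_sum fun m hm => ?_
    obtain ⟨hm0, hmy, _⟩ := hF m hm
    have hm0' : (0 : ℝ) < m := by exact_mod_cast hm0
    have h2 : (m : ℝ)⁻¹ = (m : ℝ) ^ (-s) * (m : ℝ) ^ (1 / Real.log y) := by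
      rw [← Real.rpow_add hm0', ← Real.rpow_neg_one]
      congr 1
      simp only [s]
      ring
    have h3 : (m : ℝ) ^ (1 / Real.log y) ≤ Real.exp 1 := by
      rw [Real.rpow_def_of_pos hm0']
      apply Real.exp_le_exp.2
      rw [mul_one_div, div_le_one hL]
      exact Real.log_le_log hm0' hmy
    rw [h2, mul_comm (Real.exp 1)]
    gcongr
  have h4 : ENNReal.ofReal (∑ m ∈ F, (m : ℝ) ^ (-s)) ≤ zetaSum s {n | (n : ℕ) ∈ E} := by
    rw [ENNReal.ofReal_sum_of_nonneg (fun _ _ => by positivity)]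
    obtain ⟨F', hF'⟩ : ∃ F' : Finset ℕ+,
        F' = F.attach.image fun m => m.1.toPNat (hF m.1 m.2).1 := ⟨_, rfl⟩
    calc ∑ m ∈ F, ENNReal.ofReal ((m : ℝ) ^ (-s))
        = ∑ n ∈ F', ENNReal.ofReal ((n : ℝ) ^ (-s)) := by
          rw [hF', Finset.sum_image]
          · rw [← Finset.sum_attach]
            rfl
          · intro a _ b _ h
            exact Subtype.ext (congrArg PNat.val h)
      _ = ∑ n ∈ F', if n ∈ {n : ℕ+ | (n : ℕ) ∈ E} then zetaWeight s n else 0 := by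
          refine Finset.sum_congr rfl fun n hn => ?_
          simp only [hF', Finset.mem_image, Finset.mem_attach, true_and] at hn
          obtain ⟨m, rfl⟩ := hn
          rw [if_pos (show m.1.toPNat _ ∈ {n : ℕ+ | (n : ℕ) ∈ E} from (hF m.1 m.2).2.2), zetaWeight]
      _ ≤ _ := ENNReal.sum_le_tsum _
  have hZ := zetaSum_univ_le hs
  have hZ' : 1 + 1 / (s - 1) = 1 + Real.log y := by simp [s]
  rw [hZ'] at hZ
  have h5 : ∑ m ∈ F, (m : ℝ) ^ (-s) ≤ (1 + Real.log y) * zetaProb s {n | (n : ℕ) ∈ E} := by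
    have h6 : zetaSum s {n | (n : ℕ) ∈ E} =
        zetaSum s Set.univ * (zetaSum s {n | (n : ℕ) ∈ E} / zetaSum s Set.univ) :=
      (ENNReal.mul_div_cancel (zetaSum_univ_ne_zero s) (zetaSum_univ_ne_top hs)).symm
    have h7 : zetaSum s {n | (n : ℕ) ∈ E} ≤
        ENNReal.ofReal ((1 + Real.log y) * zetaProb s {n | (n : ℕ) ∈ E}) := by
      rw [h6, ENNReal.ofReal_mul (by linarith), zetaProb, ENNReal.ofReal_toReal
        (ne_top_of_le_ne_top ENNReal.one_ne_top zetaSum_div_le_one)]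
      gcongr
    exact (ENNReal.ofReal_le_ofReal_iff
      (mul_nonneg (by linarith) (zetaProb_nonneg _ _))).1 (h4.trans h7)
  calc _ ≤ _ := h1
    _ ≤ Real.exp 1 * ((1 + Real.log y) * zetaProb s {n | (n : ℕ) ∈ E}) := by gcongr
    _ = _ := by ring

/-- **Davenport–Erdős**: the multiples of `A` that are not multiples of the small elements of `A`
have small upper logarithmic density. -/
theorem exists_logSum_multiples_diff_le (A : Set ℕ) {ε : ℝ} (hε : 0 < ε) :
    ∃ T : ℕ, ∀ᶠ y : ℝ in atTop,
      logSum (multiples A \ multiples (A ∩ Set.Iic T)) y ≤ ε * Real.log y := by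
  -- The factor `2e` absorbs the loss `e * (1 + log y) ≤ 2e * log y`.
  obtain ⟨T, s₀, hs₀, h⟩ := exists_zetaProb_multiples_diff_lt A
    (ε := ε / (2 * Real.exp 1)) (by positivity)
  refine ⟨T, ?_⟩
  filter_upwards [eventually_gt_atTop 1, Real.tendsto_log_atTop.eventually_ge_atTop 1,
    Real.tendsto_log_atTop.eventually_ge_atTop (1 / (s₀ - 1))] with y hy hy1 hy2
  have hlog : 0 < Real.log y := by linarith
  have h1 := h (1 + 1 / Real.log y) (by have : 0 < 1 / Real.log y := by positivity
                                        linarith) (by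
    have : 1 / Real.log y ≤ s₀ - 1 := by
      rw [div_le_iff₀ hlog]
      rw [div_le_iff₀ (by linarith)] at hy2
      linarith
    linarith)
  have h2 := logSum_le_zetaProb (multiples A \ multiples (A ∩ Set.Iic T)) hy
  refine h2.trans ?_
  calc _ ≤ Real.exp 1 * (1 + Real.log y) * (ε / (2 * Real.exp 1)) := by
        gcongr
        exact h1.le
    _ = ε * ((1 + Real.log y) / 2) := by field_simp
    _ ≤ ε * Real.log y := by gcongr; linarith

end

/-! ### Weighted pairs in a strip: equidistribution and common divisors. -/

section
open scoped Classical

/-- The pairs of positive integers `(m, n)` with `n ≤ x` and `a * n < m < b * n`. -/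
noncomputable def strip (x a b : ℝ) : Finset (ℕ × ℕ) :=
  {p ∈ Finset.Icc 1 ⌊b * x⌋₊ ×ˢ Finset.Icc 1 ⌊x⌋₊ | a * p.2 < p.1 ∧ (p.1 : ℝ) < b * p.2}

theorem mem_strip {x a b : ℝ} {p : ℕ × ℕ} :
    p ∈ strip x a b ↔
      0 < p.1 ∧ 0 < p.2 ∧ (p.2 : ℝ) ≤ x ∧ a * p.2 < p.1 ∧ (p.1 : ℝ) < b * p.2 := by
  simp only [strip, Finset.mem_filter, Finset.mem_product, Finset.mem_Icc]
  constructor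
  · rintro ⟨⟨⟨h1, h2⟩, h3, h4⟩, h5, h6⟩
    exact ⟨h1, h3, (Nat.le_floor_iff' (by omega)).1 h4, h5, h6⟩
  · rintro ⟨h1, h2, h3, h5, h6⟩
    have hm : (0 : ℝ) < p.1 := by exact_mod_cast h1
    have hn : (0 : ℝ) < p.2 := by exact_mod_cast h2
    have hb : 0 < b := pos_of_mul_pos_left (hm.trans h6) hn.le
    exact ⟨⟨⟨h1, Nat.le_floor (h6.le.trans (by gcongr))⟩, h2, Nat.le_floor h3⟩, h5, h6⟩

/-- The sum of `1 / (m * n)` over the pairs of the strip that satisfy `S`. -/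
noncomputable def mass (x a b : ℝ) (S : ℕ → ℕ → Prop) : ℝ :=
  ∑ p ∈ strip x a b with S p.1 p.2, (p.1 : ℝ)⁻¹ * (p.2 : ℝ)⁻¹

/-- The total mass of the strip. -/
noncomputable def totalMass (x a b : ℝ) : ℝ := mass x a b fun _ _ => True

variable {x a b : ℝ}

theorem mass_nonneg (S : ℕ → ℕ → Prop) : 0 ≤ mass x a b S :=
  Finset.sum_nonneg fun _ _ => by positivity

theorem mass_mono {S S' : ℕ → ℕ → Prop} (h : ∀ m n, 0 < m → 0 < n → S m n → S' m n) :
    mass x a b S ≤ mass x a b S' := by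
  apply Finset.sum_le_sum_of_subset_of_nonneg _ (fun _ _ _ => by positivity)
  intro p hp
  rw [Finset.mem_filter] at hp ⊢
  have := mem_strip.1 hp.1
  exact ⟨hp.1, h _ _ this.1 this.2.1 hp.2⟩

theorem mass_congr {S S' : ℕ → ℕ → Prop} (h : ∀ m n, 0 < m → 0 < n → (S m n ↔ S' m n)) :
    mass x a b S = mass x a b S' :=
  le_antisymm (mass_mono fun m n hm hn => (h m n hm hn).1)
    (mass_mono fun m n hm hn => (h m n hm hn).2)

theorem mass_le_add {S S₁ S₂ : ℕ → ℕ → Prop}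
    (h : ∀ m n, 0 < m → 0 < n → S m n → S₁ m n ∨ S₂ m n) :
    mass x a b S ≤ mass x a b S₁ + mass x a b S₂ := by
  refine (mass_mono h).trans ?_
  simp only [mass]
  rw [Finset.filter_or, ← Finset.sum_union_inter]
  exact le_add_of_nonneg_right (Finset.sum_nonneg fun _ _ => by positivity)

/-- The part of the strip in the row `n`. -/
noncomputable def stripRow (x a b : ℝ) (n : ℕ) : Finset ℕ :=
  {m ∈ Finset.Icc 1 ⌊b * x⌋₊ | a * n < (m : ℕ) ∧ ((m : ℕ) : ℝ) < b * n}

/-- The part of the strip in the column `m`. -/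
noncomputable def stripCol (x a b : ℝ) (m : ℕ) : Finset ℕ :=
  {n ∈ Finset.Icc 1 ⌊x⌋₊ | a * (n : ℕ) < m ∧ (m : ℝ) < b * (n : ℕ)}

theorem mass_eq_sum_rows (S : ℕ → ℕ → Prop) :
    mass x a b S = ∑ n ∈ Finset.Icc 1 ⌊x⌋₊,
      (n : ℝ)⁻¹ * ∑ m ∈ stripRow x a b n with S m n, (m : ℝ)⁻¹ := by
  simp only [mass, strip, stripRow, Finset.filter_filter]
  rw [Finset.sum_filter, Finset.sum_product_right]
  refine Finset.sum_congr rfl fun n _ => ?_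
  rw [Finset.sum_filter, Finset.mul_sum]
  refine Finset.sum_congr rfl fun m _ => ?_
  dsimp only
  split_ifs
  · ring
  · ring

theorem mass_eq_sum_cols (S : ℕ → ℕ → Prop) :
    mass x a b S = ∑ m ∈ Finset.Icc 1 ⌊b * x⌋₊,
      (m : ℝ)⁻¹ * ∑ n ∈ stripCol x a b m with S m n, (n : ℝ)⁻¹ := by
  simp only [mass, strip, stripCol, Finset.filter_filter]
  rw [Finset.sum_filter, Finset.sum_product]
  refine Finset.sum_congr rfl fun m _ => ?_
  rw [Finset.sum_filter, Finset.mul_sum]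
  refine Finset.sum_congr rfl fun n _ => ?_
  dsimp only
  split_ifs
  · ring
  · ring

/-- The error made by moving the rows of the strip. -/
noncomputable def rowError (x a : ℝ) : ℝ :=
  ∑ n ∈ Finset.Icc 1 ⌊x⌋₊, (n : ℝ)⁻¹ * (max 1 (a * n))⁻¹

/-- The error made by moving the columns of the strip. -/
noncomputable def colError (x b : ℝ) : ℝ :=
  ∑ m ∈ Finset.Icc 1 ⌊b * x⌋₊, (m : ℝ)⁻¹ * (max 1 (m / b))⁻¹

/-- The mass of a pair of residue classes. -/
noncomputable def residueMass (x a b : ℝ) {N : ℕ} (i j : ZMod N) : ℝ :=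
  mass x a b fun m n => (m : ZMod N) = i ∧ (n : ZMod N) = j

/-- Each row is an interval of integers exceeding `a * n`, so changing the residue of `m` costs at
most `(max 1 (a * n))⁻¹` in row `n`; `rowError` adds these costs up. -/
theorem residueMass_le_row {N : ℕ} [NeZero N] (i i' j : ZMod N) :
    residueMass x a b i j ≤ residueMass x a b i' j + rowError x a := by
  simp only [residueMass]
  rw [mass_eq_sum_rows, mass_eq_sum_rows, rowError, ← Finset.sum_add_distrib]
  refine Finset.sum_le_sum fun n hn => ?_
  rw [← mul_add]
  refine mul_le_mul_of_nonneg_left ?_ (by positivity)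
  by_cases hj : (n : ZMod N) = j
  · simp only [hj, and_true]
    refine sum_inv_residue_le (by positivity) (fun m hm => ?_) (fun m hm m' hm' k h1 h2 => ?_) i i'
    · simp only [stripRow, Finset.mem_filter, Finset.mem_Icc] at hm
      exact max_le (by exact_mod_cast hm.1.1) hm.2.1.le
    · simp only [stripRow, Finset.mem_filter, Finset.mem_Icc] at hm hm' ⊢
      have h1' : (m : ℝ) ≤ k := by exact_mod_cast h1
      have h2' : (k : ℝ) ≤ m' := by exact_mod_cast h2
      exact ⟨⟨by omega, by omega⟩, by linarith, by linarith⟩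
  · simp only [hj, and_false, Finset.filter_false, Finset.sum_empty, zero_add]
    positivity

/-- The same shift along columns, whose entries satisfy `n > m / b`; convexity of a column uses `0 ≤
a`. -/
theorem residueMass_le_col {N : ℕ} [NeZero N] (ha : 0 ≤ a) (hb : 0 < b) (i j j' : ZMod N) :
    residueMass x a b i j ≤ residueMass x a b i j' + colError x b := by
  simp only [residueMass]
  rw [mass_eq_sum_cols, mass_eq_sum_cols, colError, ← Finset.sum_add_distrib]
  refine Finset.sum_le_sum fun m hm => ?_
  rw [← mul_add]
  refine mul_le_mul_of_nonneg_left ?_ (by positivity)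
  by_cases hi : (m : ZMod N) = i
  · simp only [hi, true_and]
    refine sum_inv_residue_le (by positivity) (fun n hn => ?_) (fun n hn n' hn' k h1 h2 => ?_) j j'
    · simp only [stripCol, Finset.mem_filter, Finset.mem_Icc] at hn
      refine max_le (by exact_mod_cast hn.1.1) ?_
      rw [div_le_iff₀ hb]
      linarith [hn.2.2]
    · simp only [stripCol, Finset.mem_filter, Finset.mem_Icc] at hn hn' ⊢
      have h1' : (n : ℝ) ≤ k := by exact_mod_cast h1
      have h2' : (k : ℝ) ≤ n' := by exact_mod_cast h2
      refine ⟨⟨by omega, by omega⟩, ?_, ?_⟩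
      · nlinarith
      · nlinarith
  · simp only [hi, false_and, Finset.filter_false, Finset.sum_empty, zero_add]
    positivity

theorem residueMass_le {N : ℕ} [NeZero N] (ha : 0 ≤ a) (hb : 0 < b) (i i' j j' : ZMod N) :
    residueMass x a b i j ≤ residueMass x a b i' j' + (rowError x a + colError x b) := by
  linarith [residueMass_le_row (x := x) (a := a) (b := b) i i' j,
    residueMass_le_col (x := x) ha hb i' j j']

theorem mass_periodic_eq_sum {N : ℕ} [NeZero N] (P : Finset (ZMod N × ZMod N)) :
    mass x a b (fun m n => ((m : ZMod N), (n : ZMod N)) ∈ P) =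
      ∑ c ∈ P, residueMass x a b c.1 c.2 := by
  simp only [mass, residueMass]
  rw [← Finset.sum_fiberwise_of_maps_to (t := P)
    (g := fun p : ℕ × ℕ => ((p.1 : ZMod N), (p.2 : ZMod N)))
    (fun p hp => (Finset.mem_filter.1 hp).2)]
  refine Finset.sum_congr rfl fun c hc => ?_
  congr 1
  ext p
  simp only [Finset.mem_filter, Prod.ext_iff]
  constructor
  · rintro ⟨⟨h1, _⟩, h2⟩
    exact ⟨h1, h2⟩
  · rintro ⟨h1, h2⟩
    refine ⟨⟨h1, ?_⟩, h2⟩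
    rw [h2.1, h2.2]
    exact hc

/-- Periodic sets are equidistributed in the strip. -/
theorem abs_mass_periodic_sub_le {N : ℕ} [NeZero N] (ha : 0 ≤ a) (hb : 0 < b)
    (P : Finset (ZMod N × ZMod N)) :
    |mass x a b (fun m n => ((m : ZMod N), (n : ZMod N)) ∈ P) -
      (P.card : ℝ) / (N : ℝ) ^ 2 * totalMass x a b| ≤
        P.card * (rowError x a + colError x b) := by
  set e := rowError x a + colError x b
  have hN : (0 : ℝ) < (N : ℝ) ^ 2 := by
    have : 0 < N := Nat.pos_of_neZero N
    positivity
  have htot : totalMass x a b = ∑ c : ZMod N × ZMod N, residueMass x a b c.1 c.2 := by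
    rw [← mass_periodic_eq_sum, totalMass]
    simp
  have hcard : (Finset.univ : Finset (ZMod N × ZMod N)).card = N ^ 2 := by
    rw [Finset.card_univ, Fintype.card_prod, ZMod.card, sq]
  -- The `N ^ 2` residue masses differ pairwise by at most `e`, hence each differs from their
  -- average by at most `e`.
  have hsingle : ∀ c : ZMod N × ZMod N,
      |residueMass x a b c.1 c.2 - totalMass x a b / (N : ℝ) ^ 2| ≤ e := by
    intro c
    have h1 : (N : ℝ) ^ 2 * residueMass x a b c.1 c.2 ≤ totalMass x a b + (N : ℝ) ^ 2 * e := by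
      have := Finset.sum_le_sum (s := Finset.univ) fun (d : ZMod N × ZMod N) _ =>
        residueMass_le (x := x) ha hb c.1 d.1 c.2 d.2
      rw [Finset.sum_const, Finset.sum_add_distrib, Finset.sum_const, ← htot, hcard] at this
      simpa only [nsmul_eq_mul, Nat.cast_pow] using this
    have h2 : totalMass x a b ≤ (N : ℝ) ^ 2 * residueMass x a b c.1 c.2 + (N : ℝ) ^ 2 * e := by
      have := Finset.sum_le_sum (s := Finset.univ) fun (d : ZMod N × ZMod N) _ =>
        residueMass_le (x := x) ha hb d.1 c.1 d.2 c.2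
      rw [Finset.sum_const, ← htot, hcard] at this
      simp only [nsmul_eq_mul, Nat.cast_pow] at this
      rwa [mul_add] at this
    rw [abs_le]
    constructor
    · rw [neg_le_sub_iff_le_add, div_le_iff₀ hN]
      linarith
    · rw [sub_le_iff_le_add, ← mul_le_mul_iff_of_pos_left hN, mul_add, mul_div_cancel₀ _ hN.ne']
      linarith
  have heq : mass x a b (fun m n => ((m : ZMod N), (n : ZMod N)) ∈ P) -
      (P.card : ℝ) / (N : ℝ) ^ 2 * totalMass x a b =
        ∑ c ∈ P, (residueMass x a b c.1 c.2 - totalMass x a b / (N : ℝ) ^ 2) := by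
    rw [Finset.sum_sub_distrib, Finset.sum_const, mass_periodic_eq_sum, nsmul_eq_mul]
    ring
  rw [heq]
  refine (Finset.abs_sum_le_sum_abs _ _).trans ?_
  refine (Finset.sum_le_sum fun c _ => hsingle c).trans ?_
  simp

/-- Division by `d` preserves the slope `m / n` and decreases `n`, so it maps the strip injectively
into itself, while the weight scales by `d⁻²`. -/
theorem mass_common_multiple_le {d : ℕ} (hd : 0 < d) (S : ℕ → ℕ → Prop) :
    mass x a b (fun m n => d ∣ m ∧ d ∣ n ∧ S (m / d) (n / d)) ≤
      ((d : ℝ) ^ 2)⁻¹ * mass x a b S := by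
  have hd' : (0 : ℝ) < d := by exact_mod_cast hd
  have hd1 : (1 : ℝ) ≤ d := by exact_mod_cast hd
  set F : Finset (ℕ × ℕ) := {p ∈ strip x a b | d ∣ p.1 ∧ d ∣ p.2 ∧ S (p.1 / d) (p.2 / d)}
  have hinj : Set.InjOn (fun p : ℕ × ℕ => (p.1 / d, p.2 / d)) (F : Set (ℕ × ℕ)) := by
    intro p hp p' hp' h
    simp only [F, Finset.coe_filter, Set.mem_ofPred_eq] at hp hp'
    simp only [Prod.mk.injEq] at h
    exact Prod.ext ((Nat.div_left_inj hp.2.1 hp'.2.1).1 h.1)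
      ((Nat.div_left_inj hp.2.2.1 hp'.2.2.1).1 h.2)
  calc mass x a b (fun m n => d ∣ m ∧ d ∣ n ∧ S (m / d) (n / d))
      = ∑ p ∈ F, ((d : ℝ) ^ 2)⁻¹ * (((p.1 / d : ℕ) : ℝ)⁻¹ * ((p.2 / d : ℕ) : ℝ)⁻¹) := by
        refine Finset.sum_congr (by ext p; simp only [F, Finset.mem_filter]) fun p hp => ?_
        simp only [F, Finset.mem_filter] at hp
        rw [Nat.cast_div hp.2.1 hd'.ne', Nat.cast_div hp.2.2.1 hd'.ne']
        field_simp
    _ = ((d : ℝ) ^ 2)⁻¹ * ∑ p ∈ F.image (fun p : ℕ × ℕ => (p.1 / d, p.2 / d)),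
          (p.1 : ℝ)⁻¹ * (p.2 : ℝ)⁻¹ := by
        rw [← Finset.mul_sum, Finset.sum_image hinj]
    _ ≤ _ := by
        refine mul_le_mul_of_nonneg_left ?_ (by positivity)
        apply Finset.sum_le_sum_of_subset_of_nonneg _ (fun _ _ _ => by positivity)
        intro p' hp'
        simp only [F, Finset.mem_image, Finset.mem_filter] at hp'
        obtain ⟨⟨m, n⟩, ⟨hp, ⟨m, rfl⟩, ⟨n, rfl⟩, hS⟩, rfl⟩ := hp'
        simp only [Nat.mul_div_cancel_left _ hd] at hS ⊢
        rw [Finset.mem_filter]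
        refine ⟨?_, hS⟩
        rw [mem_strip] at hp ⊢
        push_cast at hp ⊢
        obtain ⟨h1, h2, h3, h4, h5⟩ := hp
        have hn0 : (0 : ℝ) ≤ n := by positivity
        refine ⟨Nat.pos_of_mul_pos_left h1, Nat.pos_of_mul_pos_left h2, by nlinarith, ?_, ?_⟩
        · rw [← mul_lt_mul_iff_of_pos_left hd']
          linarith
        · rw [← mul_lt_mul_iff_of_pos_left hd']
          linarith

/-- Sort the pairs by their gcd `d`: each class has at most `d⁻²` times the coprime mass, and `∑ d⁻²
≤ 2`. -/
theorem totalMass_le_two_mul_coprime :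
    totalMass x a b ≤ 2 * mass x a b fun m n => m.Coprime n := by
  have h1 : totalMass x a b = ∑ d ∈ Finset.Ioc 0 ⌊x⌋₊, mass x a b (fun m n => m.gcd n = d) := by
    have hmaps : ∀ p ∈ strip x a b, p.1.gcd p.2 ∈ Finset.Ioc 0 ⌊x⌋₊ := by
      intro p hp
      have h := mem_strip.1 hp
      rw [Finset.mem_Ioc]
      refine ⟨Nat.gcd_pos_of_pos_left _ h.1, Nat.le_floor (le_trans ?_ h.2.2.1)⟩
      exact_mod_cast Nat.gcd_le_right _ h.2.1
    simp only [totalMass, mass, Finset.filter_true]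
    exact (Finset.sum_fiberwise_of_maps_to hmaps _).symm
  rw [h1]
  calc _ ≤ ∑ d ∈ Finset.Ioc 0 ⌊x⌋₊, ((d : ℝ) ^ 2)⁻¹ * mass x a b (fun m n => m.Coprime n) := by
        refine Finset.sum_le_sum fun d hd => ?_
        refine le_trans (mass_mono fun m n hm hn h => ?_)
          (mass_common_multiple_le (Finset.mem_Ioc.1 hd).1 _)
        refine ⟨h ▸ Nat.gcd_dvd_left m n, h ▸ Nat.gcd_dvd_right m n, ?_⟩
        rw [← h]
        exact Nat.coprime_div_gcd_div_gcd (Nat.gcd_pos_of_pos_left _ hm)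
    _ ≤ _ := by
        rw [← Finset.sum_mul]
        refine mul_le_mul_of_nonneg_right ?_ (mass_nonneg _)
        simpa using sum_Ioc_inv_sq_le 0 ⌊x⌋₊

theorem mass_common_divisor_le (T : ℕ) :
    mass x a b (fun m n => ∃ d, T < d ∧ d ∣ m ∧ d ∣ n) ≤ 2 / (T + 1) * totalMass x a b := by
  have h1 : mass x a b (fun m n => ∃ d, T < d ∧ d ∣ m ∧ d ∣ n) ≤
      ∑ d ∈ Finset.Ioc T ⌊x⌋₊, mass x a b (fun m n => d ∣ m ∧ d ∣ n ∧ True) := by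
    simp only [mass, Finset.sum_filter]
    rw [Finset.sum_comm]
    refine Finset.sum_le_sum fun p hp => ?_
    have hp' := mem_strip.1 hp
    split_ifs with h
    · obtain ⟨d, hT, hm, hn⟩ := h
      have hd : d ∈ Finset.Ioc T ⌊x⌋₊ := by
        refine Finset.mem_Ioc.2 ⟨hT, Nat.le_floor (le_trans ?_ hp'.2.2.1)⟩
        exact_mod_cast Nat.le_of_dvd hp'.2.1 hn
      refine le_trans (le_of_eq ?_) (Finset.single_le_sum (fun d _ => ?_) hd)
      · rw [if_pos ⟨hm, hn, trivial⟩]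
      · split_ifs
        · positivity
        · exact le_rfl
    · refine Finset.sum_nonneg fun d _ => ?_
      split_ifs
      · positivity
      · exact le_rfl
  refine h1.trans ?_
  calc _ ≤ ∑ d ∈ Finset.Ioc T ⌊x⌋₊, ((d : ℝ) ^ 2)⁻¹ * totalMass x a b :=
        Finset.sum_le_sum fun d hd =>
          mass_common_multiple_le (by have := (Finset.mem_Ioc.1 hd).1; omega) (fun _ _ => True)
    _ ≤ _ := by
        rw [← Finset.sum_mul]
        exact mul_le_mul_of_nonneg_right (sum_Ioc_inv_sq_le T ⌊x⌋₊) (mass_nonneg _)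

end

/-! ### Estimates for masses, errors and the total mass. -/

section
open scoped Classical

variable {x a b : ℝ}

/-- This transfers smallness of logarithmic density to the strip. The bound `G` for a row is left
free because the two regimes use different ones: `log (b / a)` when `a > 0`, and `1 + log (b * x)`
when `a = 0`. -/
theorem mass_row_set_le (E : Set ℕ) {G : ℝ}
    (hG : ∀ n : ℕ, 0 < n → (n : ℝ) ≤ x →
      ∑ m ∈ stripRow x a b n, (m : ℝ)⁻¹ ≤ G + (max 1 (a * n))⁻¹) :
    mass x a b (fun _ n => n ∈ E) ≤ logSum E x * G + rowError x a := by
  rw [mass_eq_sum_rows, logSum, rowError, Finset.sum_filter, Finset.sum_mul,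
    ← Finset.sum_add_distrib]
  refine Finset.sum_le_sum fun n hn => ?_
  rw [Finset.mem_Icc] at hn
  by_cases hE : n ∈ E
  · simp only [hE, Finset.filter_true, if_true]
    rw [← mul_add]
    exact mul_le_mul_of_nonneg_left
      (hG n hn.1 ((Nat.le_floor_iff' (by omega)).1 hn.2)) (by positivity)
  · simp only [hE, Finset.filter_false, Finset.sum_empty, mul_zero, if_false, zero_mul, zero_add]
    positivity

theorem mass_col_set_le (E : Set ℕ) {G : ℝ}
    (hG : ∀ m : ℕ, 0 < m → ∑ n ∈ stripCol x a b m, (n : ℝ)⁻¹ ≤ G + (max 1 (m / b))⁻¹) :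
    mass x a b (fun m _ => m ∈ E) ≤ logSum E (b * x) * G + colError x b := by
  rw [mass_eq_sum_cols, logSum, colError, Finset.sum_filter, Finset.sum_mul,
    ← Finset.sum_add_distrib]
  refine Finset.sum_le_sum fun m hm => ?_
  rw [Finset.mem_Icc] at hm
  by_cases hE : m ∈ E
  · simp only [hE, Finset.filter_true, if_true]
    rw [← mul_add]
    exact mul_le_mul_of_nonneg_left (hG m hm.1) (by positivity)
  · simp only [hE, Finset.filter_false, Finset.sum_empty, mul_zero, if_false, zero_mul, zero_add]
    positivity

theorem sum_stripRow_le (ha : 0 < a) (hab : a < b) {n : ℕ} (hn : 0 < n) :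
    ∑ m ∈ stripRow x a b n, (m : ℝ)⁻¹ ≤ Real.log (b / a) + (max 1 (a * n))⁻¹ := by
  have hn' : (0 : ℝ) < n := by exact_mod_cast hn
  have h := sum_inv_le_log_div_add (J := stripRow x a b n) (u := a * n) (v := b * n)
    (by positivity) (by gcongr) (fun m hm => by
      simp only [stripRow, Finset.mem_filter, Finset.mem_Icc] at hm
      exact ⟨hm.1.1, hm.2⟩)
  rwa [mul_div_mul_right _ _ hn'.ne'] at h

theorem sum_stripCol_le (ha : 0 < a) (hab : a < b) {m : ℕ} (hm : 0 < m) :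
    ∑ n ∈ stripCol x a b m, (n : ℝ)⁻¹ ≤ Real.log (b / a) + (max 1 (m / b))⁻¹ := by
  have hm' : (0 : ℝ) < m := by exact_mod_cast hm
  have hb : 0 < b := ha.trans hab
  have h := sum_inv_le_log_div_add (J := stripCol x a b m) (u := m / b) (v := m / a)
    (by positivity) (by gcongr) (fun n hn => by
      simp only [stripCol, Finset.mem_filter, Finset.mem_Icc] at hn
      refine ⟨hn.1.1, ?_, ?_⟩
      · rw [div_lt_iff₀ hb]
        linarith [hn.2.2]
      · rw [lt_div_iff₀ ha]
        linarith [hn.2.1])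
  rwa [div_div_div_cancel_left' _ _ hm'.ne'] at h

theorem sum_stripRow_le_log (hy : 1 ≤ b * x) (n : ℕ) :
    ∑ m ∈ stripRow x a b n, (m : ℝ)⁻¹ ≤ 1 + Real.log (b * x) :=
  (Finset.sum_le_sum_of_subset_of_nonneg (Finset.filter_subset _ _)
    (fun _ _ _ => by positivity)).trans (sum_Icc_inv_le_one_add_log hy)

theorem sum_stripCol_le_log (hx : 1 ≤ x) (m : ℕ) :
    ∑ n ∈ stripCol x a b m, (n : ℝ)⁻¹ ≤ 1 + Real.log x :=
  (Finset.sum_le_sum_of_subset_of_nonneg (Finset.filter_subset _ _)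
    (fun _ _ _ => by positivity)).trans (sum_Icc_inv_le_one_add_log hx)

theorem rowError_le_two_div (ha : 0 < a) : rowError x a ≤ 2 / a := by
  calc rowError x a ≤ ∑ n ∈ Finset.Ioc 0 ⌊x⌋₊, a⁻¹ * ((n : ℝ) ^ 2)⁻¹ := by
        refine Finset.sum_le_sum fun n hn => ?_
        have hn' : (0 : ℝ) < n := by exact_mod_cast (Finset.mem_Ioc.1 hn).1
        calc (n : ℝ)⁻¹ * (max 1 (a * n))⁻¹ ≤ (n : ℝ)⁻¹ * (a * n)⁻¹ := by
              gcongr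
              exact le_max_right _ _
          _ = _ := by field_simp
    _ ≤ a⁻¹ * 2 := by
        rw [← Finset.mul_sum]
        gcongr
        simpa using sum_Ioc_inv_sq_le 0 ⌊x⌋₊
    _ = 2 / a := by ring

theorem rowError_le_log (hx : 1 ≤ x) : rowError x a ≤ 1 + Real.log x := by
  refine le_trans (Finset.sum_le_sum fun n _ => ?_) (sum_Icc_inv_le_one_add_log hx)
  exact mul_le_of_le_one_right (by positivity) (inv_le_one_of_one_le₀ (le_max_left _ _))

theorem colError_le_log (hy : 1 ≤ b * x) : colError x b ≤ 1 + Real.log (b * x) := by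
  refine le_trans (Finset.sum_le_sum fun n _ => ?_) (sum_Icc_inv_le_one_add_log hy)
  exact mul_le_of_le_one_right (by positivity) (inv_le_one_of_one_le₀ (le_max_left _ _))

/-- Terms with `m ≤ b` form a harmonic sum; those with `m > b` are at most `b / m ^ 2` and sum to at
most `2`. The shift in `b + 2` keeps the logarithm positive for small `b`. -/
theorem colError_le_log_add_two (hb : 0 < b) : colError x b ≤ 3 + Real.log (b + 2) := by
  set M := ⌊b * x⌋₊
  have hterm : ∀ m ∈ Finset.Icc 1 M, (m : ℝ)⁻¹ * (max 1 (m / b))⁻¹ ≤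
      if m ≤ ⌊b⌋₊ then (m : ℝ)⁻¹ else b * ((m : ℝ) ^ 2)⁻¹ := by
    intro m hm
    have hm' : (0 : ℝ) < m := by exact_mod_cast (Finset.mem_Icc.1 hm).1
    split_ifs
    · exact mul_le_of_le_one_right (by positivity) (inv_le_one_of_one_le₀ (le_max_left _ _))
    · calc (m : ℝ)⁻¹ * (max 1 (m / b))⁻¹ ≤ (m : ℝ)⁻¹ * (m / b)⁻¹ := by
            gcongr
            exact le_max_right _ _
        _ = _ := by field_simp
  refine (Finset.sum_le_sum hterm).trans ?_
  rw [Finset.sum_ite]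
  have h1 : ∑ m ∈ Finset.Icc 1 M with m ≤ ⌊b⌋₊, (m : ℝ)⁻¹ ≤ 1 + Real.log (b + 2) := by
    refine le_trans (Finset.sum_le_sum_of_subset_of_nonneg ?_ (fun _ _ _ => by positivity))
      (sum_Icc_inv_le_one_add_log (y := b + 2) (by linarith))
    intro m hm
    simp only [Finset.mem_filter, Finset.mem_Icc] at hm ⊢
    exact ⟨hm.1.1, hm.2.trans (Nat.floor_mono (by linarith))⟩
  have h2 : ∑ m ∈ Finset.Icc 1 M with ¬ m ≤ ⌊b⌋₊, b * ((m : ℝ) ^ 2)⁻¹ ≤ 2 := by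
    rw [← Finset.mul_sum]
    have h3 : ∑ m ∈ Finset.Icc 1 M with ¬ m ≤ ⌊b⌋₊, ((m : ℝ) ^ 2)⁻¹ ≤ 2 / ((⌊b⌋₊ : ℝ) + 1) := by
      refine le_trans (Finset.sum_le_sum_of_subset_of_nonneg ?_ (fun _ _ _ => by positivity))
        (sum_Ioc_inv_sq_le ⌊b⌋₊ M)
      intro m hm
      simp only [Finset.mem_filter, Finset.mem_Icc, Finset.mem_Ioc] at hm ⊢
      omega
    have h4 : b ≤ (⌊b⌋₊ : ℝ) + 1 := (Nat.lt_floor_add_one b).le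
    calc _ ≤ ((⌊b⌋₊ : ℝ) + 1) * (2 / ((⌊b⌋₊ : ℝ) + 1)) := by gcongr
      _ = 2 := by field_simp
  linarith

/-- Row `n` has harmonic sum at least `log (b / a) - 1 / (a n)`; weighting by `1 / n` and summing
makes the correction a convergent series. -/
theorem log_mul_log_sub_le_totalMass (ha : 0 < a) (hab : a < b) (hx : 1 ≤ x) :
    Real.log (b / a) * Real.log x - 2 / a ≤ totalMass x a b := by
  have hb : 0 < b := ha.trans hab
  have hlog : 0 ≤ Real.log (b / a) := Real.log_nonneg (by rw [le_div_iff₀ ha]; linarith)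
  have h1 : Real.log x ≤ ∑ n ∈ Finset.Icc 1 ⌊x⌋₊, (n : ℝ)⁻¹ := by
    refine (log_le_sum_inv (by linarith) (Nat.lt_floor_add_one x).le).trans ?_
    exact Finset.sum_le_sum_of_subset_of_nonneg (Finset.filter_subset _ _)
      (fun _ _ _ => by positivity)
  have h2 : ∑ n ∈ Finset.Icc 1 ⌊x⌋₊, ((n : ℝ) ^ 2)⁻¹ ≤ 2 := by
    exact (sum_Ioc_inv_sq_le 0 ⌊x⌋₊).trans_eq (by norm_num)
  calc Real.log (b / a) * Real.log x - 2 / a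
      ≤ Real.log (b / a) * ∑ n ∈ Finset.Icc 1 ⌊x⌋₊, (n : ℝ)⁻¹ -
          a⁻¹ * ∑ n ∈ Finset.Icc 1 ⌊x⌋₊, ((n : ℝ) ^ 2)⁻¹ := by
        have : a⁻¹ * ∑ n ∈ Finset.Icc 1 ⌊x⌋₊, ((n : ℝ) ^ 2)⁻¹ ≤ 2 / a := by
          rw [div_eq_inv_mul]
          gcongr
        gcongr
    _ = ∑ n ∈ Finset.Icc 1 ⌊x⌋₊, (n : ℝ)⁻¹ * (Real.log (b / a) - (a * n)⁻¹) := by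
        rw [Finset.mul_sum, Finset.mul_sum, ← Finset.sum_sub_distrib]
        refine Finset.sum_congr rfl fun n _ => ?_
        rw [mul_inv, sq, mul_inv]
        ring
    _ ≤ totalMass x a b := by
        rw [totalMass, mass_eq_sum_rows]
        refine Finset.sum_le_sum fun n hn => mul_le_mul_of_nonneg_left ?_ (by positivity)
        rw [Finset.mem_Icc] at hn
        have hn' : (0 : ℝ) < n := by exact_mod_cast hn.1
        have hnx : (n : ℝ) ≤ x := (Nat.le_floor_iff' (by omega)).1 hn.2
        have h := log_div_sub_le_sum_inv (M := ⌊b * x⌋₊) (u := a * n) (v := b * n)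
          (by positivity) (by positivity)
          ((mul_le_mul_of_nonneg_left hnx hb.le).trans (Nat.lt_floor_add_one _).le)
        rw [mul_div_mul_right _ _ hn'.ne'] at h
        simpa only [Finset.filter_true, stripRow] using h

theorem log_mul_log_le_totalMass_zero (hx : 1 ≤ x) (hy : 1 ≤ b * x) :
    (Real.log (min x (b * x)) / 2 - 1) * (Real.log (b * x) / 2) ≤ totalMass x 0 b := by
  set y := b * x
  have hx0 : 0 < x := by linarith
  have hb : 0 < b := pos_of_mul_pos_left (by linarith : 0 < b * x) hx0.le
  -- Only the rows `x / w < n ≤ x` are used. Their harmonic sum is at least `log w - 1`, and each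
  -- reaches up to `b * n ≥ y / w ≥ √y`, so has row sum at least `log √y`.
  set w := √(min x y)
  have hmin : 1 ≤ min x y := le_min hx hy
  have hw : 1 ≤ w := Real.one_le_sqrt.2 hmin
  have hwx : w ≤ x := by
    rw [Real.sqrt_le_left hx0.le]
    nlinarith [min_le_left x y]
  have hwy : w ≤ √y := Real.sqrt_le_sqrt (min_le_right _ _)
  have hsy : 1 ≤ √y := Real.one_le_sqrt.2 hy
  have hlogw : Real.log w = Real.log (min x y) / 2 := Real.log_sqrt (by linarith)
  have hlogy : Real.log √y = Real.log y / 2 := Real.log_sqrt (by linarith)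
  have hlogy0 : 0 ≤ Real.log √y := Real.log_nonneg hsy
  rw [← hlogw, ← hlogy]
  have h1 : Real.log w - 1 ≤ ∑ n ∈ Finset.Icc 1 ⌊x⌋₊ with (x / w < (n : ℕ)), (n : ℝ)⁻¹ := by
    have h := log_div_sub_le_sum_inv (M := ⌊x⌋₊) (u := x / w) (v := ⌊x⌋₊ + 1)
      (by positivity) (by positivity) le_rfl
    have h2 : Real.log w ≤ Real.log (((⌊x⌋₊ : ℝ) + 1) / (x / w)) := by
      apply Real.log_le_log (by linarith)
      rw [le_div_iff₀ (by positivity), mul_div_cancel₀ _ (by positivity)]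
      exact (Nat.lt_floor_add_one x).le
    have h3 : (x / w)⁻¹ ≤ 1 := inv_le_one_of_one_le₀ (by rwa [one_le_div (by linarith)])
    have h4 : ∑ m ∈ Finset.Icc 1 ⌊x⌋₊ with
          (x / w < (m : ℕ) ∧ ((m : ℕ) : ℝ) < (⌊x⌋₊ : ℝ) + 1), (m : ℝ)⁻¹ ≤
        ∑ n ∈ Finset.Icc 1 ⌊x⌋₊ with (x / w < (n : ℕ)), (n : ℝ)⁻¹ := by
      apply Finset.sum_le_sum_of_subset_of_nonneg _ (fun _ _ _ => by positivity)
      intro m hm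
      simp only [Finset.mem_filter] at hm ⊢
      exact ⟨hm.1, hm.2.1⟩
    linarith
  calc (Real.log w - 1) * Real.log √y
      ≤ (∑ n ∈ Finset.Icc 1 ⌊x⌋₊ with (x / w < (n : ℕ)), (n : ℝ)⁻¹) * Real.log √y := by gcongr
    _ ≤ ∑ n ∈ Finset.Icc 1 ⌊x⌋₊ with (x / w < (n : ℕ)),
          (n : ℝ)⁻¹ * ∑ m ∈ stripRow x 0 b n, (m : ℝ)⁻¹ := by
        rw [Finset.sum_mul]
        refine Finset.sum_le_sum fun n hn => mul_le_mul_of_nonneg_left ?_ (by positivity)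
        simp only [Finset.mem_filter, Finset.mem_Icc] at hn
        have hn' : (0 : ℝ) < n := by exact_mod_cast hn.1.1
        have hnx : (n : ℝ) ≤ x := (Nat.le_floor_iff' (by omega)).1 hn.1.2
        have h5 : √y ≤ b * n := by
          calc √y = y / √y := (Real.div_sqrt).symm
            _ ≤ y / w := by gcongr
            _ = b * (x / w) := by simp only [y]; ring
            _ ≤ b * n := by gcongr; exact hn.2.le
        refine (Real.log_le_log (by linarith) h5).trans ?_
        have h6 := log_le_sum_inv (M := ⌊b * x⌋₊) (v := b * n) (by positivity)
          ((mul_le_mul_of_nonneg_left hnx hb.le).trans (Nat.lt_floor_add_one _).le)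
        refine h6.trans (Finset.sum_le_sum_of_subset_of_nonneg ?_ (fun _ _ _ => by positivity))
        intro m hm
        simp only [stripRow, Finset.mem_filter, Finset.mem_Icc] at hm ⊢
        refine ⟨hm.1, ?_, hm.2⟩
        rw [zero_mul]
        exact_mod_cast hm.1.1
    _ ≤ totalMass x 0 b := by
        rw [totalMass, mass_eq_sum_rows]
        simp only [Finset.filter_true]
        exact Finset.sum_le_sum_of_subset_of_nonneg (Finset.filter_subset _ _)
          (fun _ _ _ => by positivity)

/-! ### Regular strips and the two regimes of intervals. -/

/-- Along the filter `l`, the strips with parameters `a x`, `b x` have positive mass, are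
equidistributed in residue classes, and give little mass to sets of small logarithmic density. -/
structure RegularStrips (l : Filter ℝ) (a b : ℝ → ℝ) : Prop where
  bounds : ∀ᶠ x in l, 0 ≤ a x ∧ 0 < b x
  pos : ∀ᶠ x in l, 0 < totalMass x (a x) (b x)
  error : ∀ ε > 0, ∀ᶠ x in l,
    rowError x (a x) + colError x (b x) ≤ ε * totalMass x (a x) (b x)
  small : ∃ C > 0, ∀ ε > 0, ∀ E : Set ℕ, (∀ᶠ y : ℝ in atTop, logSum E y ≤ ε * Real.log y) →
    ∀ᶠ x in l, mass x (a x) (b x) (fun m _ => m ∈ E) ≤ C * ε * totalMass x (a x) (b x) ∧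
      mass x (a x) (b x) (fun _ n => n ∈ E) ≤ C * ε * totalMass x (a x) (b x)

theorem RegularStrips.sup {l l' : Filter ℝ} {a b : ℝ → ℝ} (h : RegularStrips l a b)
    (h' : RegularStrips l' a b) : RegularStrips (l ⊔ l') a b where
  bounds := eventually_sup.2 ⟨h.bounds, h'.bounds⟩
  pos := eventually_sup.2 ⟨h.pos, h'.pos⟩
  error ε hε := eventually_sup.2 ⟨h.error ε hε, h'.error ε hε⟩
  small := by
    obtain ⟨C, hC, H⟩ := h.small
    obtain ⟨C', hC', H'⟩ := h'.small
    have key : ∀ ε > 0, ∀ (W M D : ℝ), 0 ≤ W → D ≤ C + C' → M ≤ D * ε * W →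
        M ≤ (C + C') * ε * W := by
      intro ε hε W M D hW hD hM
      refine hM.trans ?_
      gcongr
    refine ⟨C + C', by positivity, fun ε hε E hE => eventually_sup.2 ⟨?_, ?_⟩⟩
    · filter_upwards [H ε hε E hE] with x hx
      exact ⟨key ε hε _ _ C (mass_nonneg _) (by linarith) hx.1,
        key ε hε _ _ C (mass_nonneg _) (by linarith) hx.2⟩
    · filter_upwards [H' ε hε E hE] with x hx
      exact ⟨key ε hε _ _ C' (mass_nonneg _) (by linarith) hx.1,
        key ε hε _ _ C' (mass_nonneg _) (by linarith) hx.2⟩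

/-- The main term `log (b / a) * log x` dominates every multiple of `log (b + 2)`. The lower bound
on `a` makes `1 / a`, hence both errors, `O(log (b + 2))`. The upper bound `b < x ^ c₃` makes `log
(b * x)` comparable with `log x`, so columns are controlled as well as rows. -/
theorem regularStrips_of_pos {l : Filter ℝ} (hl : l ≤ atTop) {a b : ℝ → ℝ} {c₂ c₃ : ℝ}
    (hc₂ : 0 < c₂) (hc₃ : 0 < c₃)
    (hbounds : ∀ᶠ x in l, 0 < a x ∧ c₂ / Real.log (b x + 2) < a x ∧ a x < b x ∧ b x < x ^ c₃)
    (htend : Tendsto (fun x : ℝ =>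
      1 / Real.log (b x + 2) * Real.log (b x / a x) * Real.log x) l atTop) :
    RegularStrips l a b := by
  have hℓ : ∀ᶠ x in l, 1 / 2 ≤ Real.log (b x + 2) := by
    filter_upwards [hbounds] with x hx
    have h2 : Real.log 2 ≤ Real.log (b x + 2) := Real.log_le_log (by norm_num) (by linarith)
    linarith [Real.log_two_gt_d9]
  have hx1 : ∀ᶠ x in l, (1 : ℝ) ≤ x := hl (eventually_ge_atTop 1)
  have hV : ∀ K : ℝ, ∀ᶠ x in l,
      K * Real.log (b x + 2) ≤ Real.log (b x / a x) * Real.log x := by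
    intro K
    filter_upwards [htend.eventually_ge_atTop K, hℓ] with x hx hℓx
    rw [← le_div_iff₀ (by linarith)]
    refine hx.trans (le_of_eq ?_)
    ring
  have hinv : ∀ᶠ x in l, 2 / a x ≤ 2 / c₂ * Real.log (b x + 2) := by
    filter_upwards [hbounds, hℓ] with x hx hℓx
    have h := hx.2.1
    rw [div_lt_iff₀ (by linarith)] at h
    rw [div_le_iff₀ hx.1, div_mul_eq_mul_div, div_mul_eq_mul_div, le_div_iff₀ hc₂]
    linarith
  have hW : ∀ᶠ x in l,
      Real.log (b x / a x) * Real.log x ≤ 2 * totalMass x (a x) (b x) := by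
    filter_upwards [hbounds, hV (4 / c₂), hinv, hx1] with x hx hVx hix hx1
    have h := log_mul_log_sub_le_totalMass hx.1 hx.2.2.1 hx1
    have h2 : 4 / c₂ * Real.log (b x + 2) = 2 * (2 / c₂ * Real.log (b x + 2)) := by ring
    linarith
  have herr : ∀ ε > 0, ∀ᶠ x in l,
      rowError x (a x) + colError x (b x) ≤ ε * totalMass x (a x) (b x) := by
    intro ε hε
    -- The `7` bounds the column error: `3 + log (b + 2) ≤ 7 * log (b + 2)`, as `log (b + 2) ≥ 1 /
    -- 2`.
    filter_upwards [hbounds, hV ((2 / c₂ + 7) * (2 / ε)), hinv, hℓ, hW] with x hx hVx hix hℓx hWx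
    have h1 := rowError_le_two_div (x := x) hx.1
    have h2 := colError_le_log_add_two (x := x) (hx.1.trans hx.2.2.1)
    have h3 : (2 / c₂ + 7) * Real.log (b x + 2) * (2 / ε) ≤ 2 * totalMass x (a x) (b x) := by
      linarith
    rw [mul_div_assoc', div_le_iff₀ hε] at h3
    linarith
  -- `b` stays away from `0`: if `b ≤ 1`, then `b > a > c₂ / log (b + 2) ≥ c₂ / log 3`.
  have htop : Tendsto (fun x => b x * x) l atTop := by
    have hlog3 : 0 < Real.log 3 := Real.log_pos (by norm_num)
    have h1 : Tendsto (fun x : ℝ => min 1 (c₂ / Real.log 3) * x) l atTop :=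
      (tendsto_id.const_mul_atTop (by positivity)).mono_left hl
    refine tendsto_atTop_mono' l ?_ h1
    filter_upwards [hbounds, hx1, hℓ] with x hx hx1 hℓx
    refine mul_le_mul_of_nonneg_right ?_ (by linarith)
    rcases le_total 1 (b x) with h | h
    · exact (min_le_left _ _).trans h
    · refine (min_le_right _ _).trans (le_trans ?_ (hx.2.1.trans hx.2.2.1).le)
      have h3 : Real.log (b x + 2) ≤ Real.log 3 := Real.log_le_log (by linarith) (by linarith)
      have : 0 < Real.log (b x + 2) := by linarith
      gcongr
  refine ⟨?_, ?_, herr, 2 * (1 + c₃) + 1, by positivity, fun ε hε E hE => ?_⟩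
  · filter_upwards [hbounds] with x hx
    exact ⟨hx.1.le, hx.1.trans hx.2.2.1⟩
  · filter_upwards [hV 1, hW, hℓ] with x h1 h2 h3
    linarith
  · filter_upwards [hbounds, hx1, hW, herr ε hε, htop.eventually hE, hl hE] with
      x hx hx1 hWx herrx hE1 hE2
    have hb : 0 < b x := hx.1.trans hx.2.2.1
    have hG : 0 ≤ Real.log (b x / a x) :=
      Real.log_nonneg (by rw [le_div_iff₀ hx.1]; linarith)
    have hlx : 0 ≤ Real.log x := Real.log_nonneg hx1
    have hlb : Real.log (b x * x) ≤ (1 + c₃) * Real.log x := by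
      rw [Real.log_mul hb.ne' (by linarith)]
      have h := Real.log_le_log hb hx.2.2.2.le
      rw [Real.log_rpow (by linarith)] at h
      linarith
    have hre : 0 ≤ rowError x (a x) := Finset.sum_nonneg fun _ _ => by positivity
    have hce : 0 ≤ colError x (b x) := Finset.sum_nonneg fun _ _ => by positivity
    have hmain : (ε * ((1 + c₃) * Real.log x)) * Real.log (b x / a x) ≤
        2 * (1 + c₃) * ε * totalMass x (a x) (b x) := by
      calc _ = (1 + c₃) * ε * (Real.log (b x / a x) * Real.log x) := by ring
        _ ≤ (1 + c₃) * ε * (2 * totalMass x (a x) (b x)) := by gcongr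
        _ = _ := by ring
    constructor
    · have h1 := mass_col_set_le (x := x) (a := a x) (b := b x) E
        (fun m hm => sum_stripCol_le hx.1 hx.2.2.1 hm)
      have h2 : logSum E (b x * x) * Real.log (b x / a x) ≤
          (ε * ((1 + c₃) * Real.log x)) * Real.log (b x / a x) := by
        refine mul_le_mul_of_nonneg_right (hE1.trans ?_) hG
        gcongr
      linarith
    · have h1 := mass_row_set_le (x := x) (a := a x) (b := b x) E
        (fun n hn _ => sum_stripRow_le hx.1 hx.2.2.1 hn)
      have h2 : logSum E x * Real.log (b x / a x) ≤
          (ε * ((1 + c₃) * Real.log x)) * Real.log (b x / a x) := by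
        refine mul_le_mul_of_nonneg_right (hE2.trans ?_) hG
        have : 0 ≤ c₃ * Real.log x := by positivity
        gcongr
        linarith
      linarith

/-- The total mass has order at least `log x * log (b * x)`, whereas the errors are at most of the
order of the sum of these two logarithms, and both tend to infinity. -/
theorem regularStrips_of_zero {l : Filter ℝ} (hl : l ≤ atTop) {a b : ℝ → ℝ} {c : ℝ}
    (ha : ∀ᶠ x in l, a x = 0) (htend : Tendsto (fun x => b x * x) l atTop)
    (hlog : ∀ᶠ x in l, Real.log x / Real.log (b x * x) < c) :
    RegularStrips l a b := by
  set c' := max 1 c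
  have hc' : 1 ≤ c' := le_max_left _ _
  have hP : ∀ K : ℝ, ∀ᶠ x in l, K ≤ Real.log x := fun K =>
    hl (Real.tendsto_log_atTop.eventually_ge_atTop K)
  have hQ : ∀ K : ℝ, ∀ᶠ x in l, K ≤ Real.log (b x * x) := fun K =>
    (Real.tendsto_log_atTop.comp htend).eventually_ge_atTop K
  have hx1 : ∀ᶠ x in l, (1 : ℝ) ≤ x := hl (eventually_ge_atTop 1)
  have hy1 : ∀ᶠ x in l, 1 ≤ b x * x := htend.eventually_ge_atTop 1
  have hW : ∀ᶠ x in l,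
      Real.log x * Real.log (b x * x) ≤ 8 * c' * totalMass x (a x) (b x) := by
    filter_upwards [ha, hx1, hy1, hlog, hP (4 * c'), hQ 1] with x hax hx1 hy1 hlogx hPx hQx
    have h := log_mul_log_le_totalMass_zero hx1 hy1
    rw [hax]
    -- This is where the bound on `log x / log (b * x)` enters: the smaller of `x` and `b * x` still
    -- has logarithm comparable with `log x`.
    have h1 : Real.log x ≤ c' * Real.log (min x (b x * x)) := by
      rcases le_total x (b x * x) with h2 | h2
      · rw [min_eq_left h2]
        nlinarith
      · rw [min_eq_right h2]
        rw [div_lt_iff₀ (by linarith)] at hlogx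
        have : c * Real.log (b x * x) ≤ c' * Real.log (b x * x) :=
          mul_le_mul_of_nonneg_right (le_max_right _ _) (by linarith)
        linarith
    have h3 : Real.log x ≤ 4 * c' * (Real.log (min x (b x * x)) / 2 - 1) := by linarith
    calc Real.log x * Real.log (b x * x)
        ≤ 4 * c' * (Real.log (min x (b x * x)) / 2 - 1) * Real.log (b x * x) := by gcongr
      _ = 8 * c' * ((Real.log (min x (b x * x)) / 2 - 1) * (Real.log (b x * x) / 2)) := by ring
      _ ≤ _ := by gcongr
  have herr : ∀ ε > 0, ∀ᶠ x in l,
      rowError x (a x) + colError x (b x) ≤ ε * totalMass x (a x) (b x) := by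
    intro ε hε
    filter_upwards [hx1, hy1, hP 1, hQ 1, hP (4 * (8 * c' / ε)), hQ (4 * (8 * c' / ε)), hW] with
      x hx1 hy1 hP1 hQ1 hPK hQK hWx
    have h1 := rowError_le_log (a := a x) hx1
    have h2 := colError_le_log hy1
    have h3 : (4 * (8 * c' / ε)) * (Real.log x + Real.log (b x * x)) ≤
        2 * (Real.log x * Real.log (b x * x)) := by nlinarith
    have h4 : (Real.log x + Real.log (b x * x)) * (2 * (8 * c')) ≤
        ε * totalMass x (a x) (b x) * (8 * c') := by
      have h5 : (4 * (8 * c' / ε)) * (Real.log x + Real.log (b x * x)) =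
        4 * (8 * c') * (Real.log x + Real.log (b x * x)) / ε := by ring
      rw [h5, div_le_iff₀ hε] at h3
      have h6 := mul_le_mul_of_nonneg_right hWx hε.le
      linarith
    have h7 : (Real.log x + Real.log (b x * x)) * 2 ≤ ε * totalMass x (a x) (b x) := by
      refine le_of_mul_le_mul_right ?_ (by positivity : 0 < 8 * c')
      linarith
    linarith
  refine ⟨?_, ?_, herr, 2 * (8 * c') + 1, by positivity, fun ε hε E hE => ?_⟩
  · filter_upwards [ha, hx1, hy1] with x hax hx1 hy1
    exact ⟨hax.ge, pos_of_mul_pos_left (by linarith : 0 < b x * x) (by linarith)⟩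
  · filter_upwards [hP 1, hQ 1, hW] with x h1 h2 h3
    have h4 : 0 < 8 * c' * totalMass x (a x) (b x) := lt_of_lt_of_le (by nlinarith) h3
    exact pos_of_mul_pos_right h4 (by positivity)
  · filter_upwards [hx1, hy1, hP 1, hQ 1, hW, herr ε hε, htend.eventually hE, hl hE] with
      x hx1 hy1 hP1 hQ1 hWx herrx hE1 hE2
    have hre : 0 ≤ rowError x (a x) := Finset.sum_nonneg fun _ _ => by positivity
    have hce : 0 ≤ colError x (b x) := Finset.sum_nonneg fun _ _ => by positivity
    have hmain : 2 * ε * (Real.log x * Real.log (b x * x)) ≤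
        2 * ε * (8 * c' * totalMass x (a x) (b x)) := by gcongr
    constructor
    · have h1 := mass_col_set_le (x := x) (a := a x) (b := b x) E (G := 1 + Real.log x)
        (fun m _ => (sum_stripCol_le_log hx1 m).trans (le_add_of_nonneg_right (by positivity)))
      have h2 : logSum E (b x * x) * (1 + Real.log x) ≤
          ε * Real.log (b x * x) * (2 * Real.log x) := by
        gcongr
        linarith
      linarith
    · have h1 := mass_row_set_le (x := x) (a := a x) (b := b x) E (G := 1 + Real.log (b x * x))
        (fun n _ _ => (sum_stripRow_le_log hy1 n).trans (le_add_of_nonneg_right (by positivity)))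
      have h2 : logSum E x * (1 + Real.log (b x * x)) ≤
          ε * Real.log x * (2 * Real.log (b x * x)) := by
        gcongr
        linarith
      linarith

end

/-! ### Truncation to periodic conditions and existence of the limit. -/

section
open scoped Classical

theorem exists_tendsto_of_approx {l : Filter ℝ} [l.NeBot] {f : ℝ → ℝ}
    (h : ∀ ε > 0, ∃ c : ℝ, ∀ᶠ x in l, |f x - c| ≤ ε) : ∃ c, Tendsto f l (𝓝 c) := by
  apply cauchy_map_iff_exists_tendsto.1
  rw [Metric.cauchy_iff]
  refine ⟨inferInstance, fun ε hε => ?_⟩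
  obtain ⟨c, hc⟩ := h (ε / 3) (by positivity)
  refine ⟨f '' {x | |f x - c| ≤ ε / 3}, image_mem_map hc, ?_⟩
  rintro _ ⟨x, hx, rfl⟩ _ ⟨y, hy, rfl⟩
  simp only [Set.mem_ofPred_eq, abs_le] at hx hy
  rw [Real.dist_eq, abs_lt]
  constructor <;> linarith [hx.1, hx.2, hy.1, hy.2]

/-- Pairs representing the rational multiples of `A`, `B` coprime to `q`. -/
def pairMultiples (A B : Set ℕ) (q m n : ℕ) : Prop :=
  m ∈ multiples A ∧ n ∈ multiples B ∧ (m * n).Coprime q ∧ m.Coprime n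

/-- The truncation of `pairMultiples` to divisors up to `T`, which is a periodic condition. -/
def pairMultiplesUpTo (A B : Set ℕ) (q T m n : ℕ) : Prop :=
  m ∈ multiples (A ∩ Set.Iic T) ∧ n ∈ multiples (B ∩ Set.Iic T) ∧ (m * n).Coprime q ∧
    ∀ d, 1 < d → d ≤ T → d ∣ m → ¬ d ∣ n

/-- Every positive `a ≤ T` divides `T!`, so divisibility by `a` depends only on the class modulo
`N`. Positivity is assumed because `multiples` excludes `0`. -/
theorem multiples_congr {A : Set ℕ} {T N m m' : ℕ} (hN : T.factorial ∣ N) (hm : 0 < m)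
    (hm' : 0 < m') (h : m ≡ m' [MOD N]) :
    m ∈ multiples (A ∩ Set.Iic T) → m' ∈ multiples (A ∩ Set.Iic T) := by
  rintro ⟨_, a, ⟨haA, haT⟩, hd⟩
  have ha : 0 < a := Nat.pos_of_dvd_of_pos hd hm
  have haN : a ∣ N := (Nat.dvd_factorial ha haT).trans hN
  exact ⟨hm', a, ⟨haA, haT⟩, (h.dvd_iff haN).1 hd⟩

theorem pairMultiplesUpTo_congr {A B : Set ℕ} {q T m n m' n' : ℕ}
    (hm : 0 < m) (hm' : 0 < m') (hn : 0 < n) (hn' : 0 < n')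
    (hmm : m ≡ m' [MOD q * T.factorial]) (hnn : n ≡ n' [MOD q * T.factorial])
    (h : pairMultiplesUpTo A B q T m n) : pairMultiplesUpTo A B q T m' n' := by
  obtain ⟨h1, h2, h3, h4⟩ := h
  refine ⟨multiples_congr (dvd_mul_left _ _) hm hm' hmm h1,
    multiples_congr (dvd_mul_left _ _) hn hn' hnn h2, ?_, fun d hd hdT hdm hdn => ?_⟩
  · have : m * n ≡ m' * n' [MOD q] := (hmm.mul hnn).of_dvd (dvd_mul_right _ _)
    rw [Nat.Coprime, ← this.gcd_eq]
    exact h3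
  · have hdN : d ∣ q * T.factorial := (Nat.dvd_factorial (by omega) hdT).mul_left q
    exact h4 d hd hdT ((hmm.dvd_iff hdN).2 hdm) ((hnn.dvd_iff hdN).2 hdn)

theorem exists_periodic_pairMultiplesUpTo (A B : Set ℕ) {q : ℕ} (hq : 0 < q) (T : ℕ) :
    ∃ N : ℕ, ∃ _ : NeZero N, ∃ P : Finset (ZMod N × ZMod N), ∀ m n : ℕ, 0 < m → 0 < n →
      (pairMultiplesUpTo A B q T m n ↔ ((m : ZMod N), (n : ZMod N)) ∈ P) := by
  have hN : NeZero (q * T.factorial) := ⟨(Nat.mul_pos hq T.factorial_pos).ne'⟩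
  refine ⟨q * T.factorial, hN,
    Finset.univ.filter fun c : ZMod (q * T.factorial) × ZMod (q * T.factorial) =>
      ∃ m n : ℕ, 0 < m ∧ 0 < n ∧ (m : ZMod _) = c.1 ∧ (n : ZMod _) = c.2 ∧ pairMultiplesUpTo A B q T m n,
    fun m n hm hn => ?_⟩
  simp only [Finset.mem_filter, Finset.mem_univ, true_and]
  constructor
  · exact fun h => ⟨m, n, hm, hn, rfl, rfl, h⟩
  · rintro ⟨m', n', hm', hn', h1, h2, h⟩
    exact pairMultiplesUpTo_congr hm' hm hn' hn ((ZMod.natCast_eq_natCast_iff _ _ _).1 h1)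
      ((ZMod.natCast_eq_natCast_iff _ _ _).1 h2) h

theorem pairMultiples_or {A B : Set ℕ} {q T m n : ℕ} (h : pairMultiples A B q m n) :
    pairMultiplesUpTo A B q T m n ∨
      (m ∈ multiples A \ multiples (A ∩ Set.Iic T) ∨
        n ∈ multiples B \ multiples (B ∩ Set.Iic T)) := by
  obtain ⟨h1, h2, h3, h4⟩ := h
  by_cases hm : m ∈ multiples (A ∩ Set.Iic T)
  · by_cases hn : n ∈ multiples (B ∩ Set.Iic T)
    · refine Or.inl ⟨hm, hn, h3, fun d hd _ hdm hdn => ?_⟩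
      have := Nat.eq_one_of_dvd_coprimes h4 hdm hdn
      omega
    · exact Or.inr (Or.inr ⟨h2, hn⟩)
  · exact Or.inr (Or.inl ⟨h1, hm⟩)

/-- If `m` and `n` are not coprime, their gcd is itself a common divisor, and truncated coprimality
forces it above `T`. -/
theorem pairMultiplesUpTo_or {A B : Set ℕ} {q T m n : ℕ} (hm : 0 < m)
    (h : pairMultiplesUpTo A B q T m n) :
    pairMultiples A B q m n ∨ ∃ d, T < d ∧ d ∣ m ∧ d ∣ n := by
  obtain ⟨h1, h2, h3, h4⟩ := h
  by_cases hg : m.Coprime n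
  · exact Or.inl ⟨multiples_mono Set.inter_subset_left h1,
      multiples_mono Set.inter_subset_left h2, h3, hg⟩
  · refine Or.inr ⟨m.gcd n, ?_, Nat.gcd_dvd_left _ _, Nat.gcd_dvd_right _ _⟩
    by_contra hT
    have hpos := Nat.gcd_pos_of_pos_left n hm
    have hne : m.gcd n ≠ 1 := hg
    exact h4 _ (by omega) (by omega) (Nat.gcd_dvd_left _ _) (Nat.gcd_dvd_right _ _)

theorem logSum_mono {E E' : Set ℕ} (h : E ⊆ E') (y : ℝ) : logSum E y ≤ logSum E' y := by
  apply Finset.sum_le_sum_of_subset_of_nonneg _ (fun _ _ _ => by positivity)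
  intro m hm
  rw [Finset.mem_filter] at hm ⊢
  exact ⟨hm.1, h hm.2⟩

/-- The relative mass of the pairs representing rational multiples has a limit. -/
theorem RegularStrips.exists_tendsto {l : Filter ℝ} [l.NeBot] {a b : ℝ → ℝ}
    (h : RegularStrips l a b) (A B : Set ℕ) {q : ℕ} (hq : 0 < q) :
    ∃ c, Tendsto (fun x => mass x (a x) (b x) (pairMultiples A B q) / totalMass x (a x) (b x))
      l (𝓝 c) := by
  apply exists_tendsto_of_approx
  intro ε hε
  obtain ⟨C, hC, hsmall⟩ := h.small
  -- Error budget: `ε / 4` for each of `A` and `B` in the upper estimate, `ε / 2` for large common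
  -- divisors in the lower one (hence `T₃ > 4 / ε`), and `ε / 2` for the periodic approximation.
  have hδ : 0 < ε / (4 * C) := by positivity
  obtain ⟨T₁, hT₁⟩ := exists_logSum_multiples_diff_le A hδ
  obtain ⟨T₂, hT₂⟩ := exists_logSum_multiples_diff_le B hδ
  obtain ⟨T₃, hT₃⟩ := exists_nat_gt (4 / ε)
  set T := max (max T₁ T₂) T₃
  have hsub : ∀ (D : Set ℕ) (S : ℕ), S ≤ T →
      multiples D \ multiples (D ∩ Set.Iic T) ⊆ multiples D \ multiples (D ∩ Set.Iic S) :=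
    fun D S hS => Set.sdiff_subset_sdiff_right
      (multiples_mono (Set.inter_subset_inter_right _ (Set.Iic_subset_Iic.2 hS)))
  have hA := hsmall _ hδ (multiples A \ multiples (A ∩ Set.Iic T))
    (hT₁.mono fun y hy => (logSum_mono (hsub A T₁ (by simp [T])) y).trans hy)
  have hB := hsmall _ hδ (multiples B \ multiples (B ∩ Set.Iic T))
    (hT₂.mono fun y hy => (logSum_mono (hsub B T₂ (by simp [T])) y).trans hy)
  obtain ⟨N, hN, P, hP⟩ := exists_periodic_pairMultiplesUpTo A B hq T
  refine ⟨(P.card : ℝ) / (N : ℝ) ^ 2, ?_⟩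
  filter_upwards [h.bounds, h.pos, h.error (ε / (2 * (P.card + 1))) (by positivity), hA, hB] with
    x hbx hWx herr hAx hBx
  set W := totalMass x (a x) (b x)
  have hper := abs_mass_periodic_sub_le (x := x) hbx.1 hbx.2 P
  rw [← mass_congr hP] at hper
  have h1 : mass x (a x) (b x) (pairMultiples A B q) ≤
      mass x (a x) (b x) (pairMultiplesUpTo A B q T) + ε / 2 * W := by
    have h2 := mass_le_add (x := x) (a := a x) (b := b x)
      fun m n _ _ (hm : pairMultiples A B q m n) => pairMultiples_or (T := T) hm
    have h3 := mass_le_add (x := x) (a := a x) (b := b x)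
      fun m n (_ : 0 < m) (_ : 0 < n) (hm : m ∈ multiples A \ multiples (A ∩ Set.Iic T) ∨
        n ∈ multiples B \ multiples (B ∩ Set.Iic T)) => hm
    have h4 : C * (ε / (4 * C)) = ε / 4 := by field_simp
    rw [h4] at hAx hBx
    linarith [hAx.1, hBx.2]
  have h5 : mass x (a x) (b x) (pairMultiplesUpTo A B q T) ≤
      mass x (a x) (b x) (pairMultiples A B q) + ε / 2 * W := by
    have h6 := mass_le_add (x := x) (a := a x) (b := b x)
      fun m n hm _ (hmn : pairMultiplesUpTo A B q T m n) => pairMultiplesUpTo_or hm hmn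
    have h7 := mass_common_divisor_le (x := x) (a := a x) (b := b x) T
    have h8 : (2 : ℝ) / (T + 1) ≤ ε / 2 := by
      have hTT : (T₃ : ℝ) ≤ T := by exact_mod_cast le_max_right _ _
      rw [div_lt_iff₀ hε] at hT₃
      rw [div_le_iff₀ (by positivity)]
      nlinarith
    have h9 := mul_le_mul_of_nonneg_right h8 hWx.le
    linarith
  have h10 : (P.card : ℝ) * (rowError x (a x) + colError x (b x)) ≤ ε / 2 * W := by
    calc _ ≤ (P.card : ℝ) * (ε / (2 * (P.card + 1)) * W) := by gcongr
      _ = P.card / (P.card + 1) * (ε / 2 * W) := by field_simp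
      _ ≤ 1 * (ε / 2 * W) := by
          gcongr
          rw [div_le_one (by positivity)]
          linarith
      _ = _ := one_mul _
  have h11 : mass x (a x) (b x) (pairMultiples A B q) / W - P.card / (N : ℝ) ^ 2 =
      (mass x (a x) (b x) (pairMultiples A B q) - P.card / (N : ℝ) ^ 2 * W) / W := by
    field_simp
  rw [h11, abs_div, abs_of_pos hWx, div_le_iff₀ hWx]
  rw [abs_le] at hper ⊢
  constructor <;> linarith [hper.1, hper.2]

/-! ### From rationals in lowest terms to pairs, and the main theorem. -/

theorem mem_fareySet_iff {x l₁ l₂ : ℝ} {r : ℚ} :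
    r ∈ fareySet x l₁ l₂ ↔ 0 < r ∧ (r.num.natAbs, r.den) ∈ strip x l₁ l₂ := by
  have hd : (0 : ℝ) < r.den := by exact_mod_cast r.den_pos
  simp only [fareySet, Set.mem_ofPred_eq, mem_strip, Set.mem_Ioo]
  refine and_congr_right fun hr => ?_
  have hnum : 0 < r.num := Rat.num_pos.2 hr
  have h1 : (r : ℝ) = (r.num.natAbs : ℝ) / r.den := by
    rw [Nat.cast_natAbs, abs_of_pos hnum]
    exact Rat.cast_def r
  rw [h1, lt_div_iff₀ hd, div_lt_iff₀ hd]
  have h2 : 0 < r.num.natAbs := by omega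
  simp [h2, r.den_pos]

theorem num_den_natCast_div {m n : ℕ} (hn : 0 < n) (h : m.Coprime n) :
    ((m : ℚ) / n).num = m ∧ ((m : ℚ) / n).den = n := by
  have h1 := Rat.num_div_eq_of_coprime (a := (m : ℤ)) (b := (n : ℤ))
    (by exact_mod_cast hn) (by simpa using h)
  have h2 := Rat.den_div_eq_of_coprime (a := (m : ℤ)) (b := (n : ℤ))
    (by exact_mod_cast hn) (by simpa using h)
  rw [Int.cast_natCast, Int.cast_natCast] at h1 h2
  exact ⟨h1, Int.ofNat_inj.1 h2⟩

theorem natAbs_num_div_den {r : ℚ} (hr : 0 < r) : ((r.num.natAbs : ℕ) : ℚ) / r.den = r := by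
  rw [Nat.cast_natAbs, abs_of_pos (Rat.num_pos.2 hr)]
  exact Rat.num_div_den r

theorem weightedSum_one_one_eq_mass {x l₁ l₂ : ℝ} {R : Set ℚ} {S : ℕ → ℕ → Prop}
    (hS : ∀ p ∈ strip x l₁ l₂, S p.1 p.2 ↔ p.1.Coprime p.2 ∧ ((p.1 : ℚ) / p.2) ∈ R) :
    weightedSum 1 1 x l₁ l₂ R = mass x l₁ l₂ S := by
  rw [weightedSum, mass]
  refine Finset.sum_bij' (fun r _ => (r.num.natAbs, r.den)) (fun p _ => (p.1 : ℚ) / p.2)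
    ?_ ?_ ?_ ?_ ?_
  · intro r hr
    rw [Finset.mem_filter, Set.Finite.mem_toFinset, mem_fareySet_iff] at hr
    rw [Finset.mem_filter]
    refine ⟨hr.1.2, (hS _ hr.1.2).2 ⟨r.reduced, ?_⟩⟩
    rw [natAbs_num_div_den hr.1.1]
    exact hr.2
  · intro p hp
    rw [Finset.mem_filter] at hp
    have hs := mem_strip.1 hp.1
    obtain ⟨hcop, hR⟩ := (hS p hp.1).1 hp.2
    rw [Finset.mem_filter, Set.Finite.mem_toFinset, mem_fareySet_iff]
    have hm : (0 : ℚ) < p.1 := by exact_mod_cast hs.1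
    have hn : (0 : ℚ) < p.2 := by exact_mod_cast hs.2.1
    obtain ⟨hnum, hden⟩ := num_den_natCast_div hs.2.1 hcop
    refine ⟨⟨by positivity, ?_⟩, hR⟩
    rw [hden, hnum]
    exact hp.1
  · intro r hr
    rw [Finset.mem_filter, Set.Finite.mem_toFinset, mem_fareySet_iff] at hr
    exact natAbs_num_div_den hr.1.1
  · intro p hp
    rw [Finset.mem_filter] at hp
    obtain ⟨hnum, hden⟩ :=
      num_den_natCast_div (mem_strip.1 hp.1).2.1 ((hS p hp.1).1 hp.2).1
    refine Prod.ext ?_ hden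
    dsimp only
    rw [hnum, Int.natAbs_natCast]
  · intro r hr
    rw [Finset.mem_filter, Set.Finite.mem_toFinset, mem_fareySet_iff] at hr
    dsimp only
    rw [Nat.cast_natAbs, abs_of_pos (Rat.num_pos.2 hr.1.1), pow_one, pow_one]

theorem weightedSum_ratMultiples {x l₁ l₂ : ℝ} (A B : Set ℕ) (q : ℕ) :
    weightedSum 1 1 x l₁ l₂ (ratMultiples A B q) = mass x l₁ l₂ (pairMultiples A B q) := by
  refine weightedSum_one_one_eq_mass fun p hp => ?_
  have hs := mem_strip.1 hp
  have hm : (0 : ℚ) < p.1 := by exact_mod_cast hs.1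
  have hn : (0 : ℚ) < p.2 := by exact_mod_cast hs.2.1
  constructor
  · rintro ⟨h1, h2, h3, h4⟩
    obtain ⟨hnum, hden⟩ := num_den_natCast_div hs.2.1 h4
    refine ⟨h4, by positivity, ?_⟩
    rw [hnum, hden, Int.natAbs_natCast]
    exact ⟨h1, h2, h3⟩
  · rintro ⟨h4, _, h⟩
    obtain ⟨hnum, hden⟩ := num_den_natCast_div hs.2.1 h4
    rw [hnum, hden, Int.natAbs_natCast] at h
    exact ⟨h.1, h.2.1, h.2.2, h4⟩

theorem weightedSum_fareySet {x l₁ l₂ : ℝ} :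
    weightedSum 1 1 x l₁ l₂ (fareySet x l₁ l₂) = mass x l₁ l₂ fun m n => m.Coprime n := by
  refine weightedSum_one_one_eq_mass fun p hp => ⟨fun h => ⟨h, ?_⟩, And.left⟩
  have hs := mem_strip.1 hp
  have hm : (0 : ℚ) < p.1 := by exact_mod_cast hs.1
  have hn : (0 : ℚ) < p.2 := by exact_mod_cast hs.2.1
  obtain ⟨hnum, hden⟩ := num_den_natCast_div hs.2.1 h
  rw [mem_fareySet_iff, hnum, hden]
  exact ⟨by positivity, hp⟩

theorem fareySet_nonempty_of_totalMass_pos {x l₁ l₂ : ℝ} (h : 0 < totalMass x l₁ l₂) :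
    (fareySet x l₁ l₂).Nonempty := by
  have h1 : 0 < weightedSum 1 1 x l₁ l₂ (fareySet x l₁ l₂) := by
    rw [weightedSum_fareySet]
    linarith [totalMass_le_two_mul_coprime (x := x) (a := l₁) (b := l₂)]
  obtain ⟨r, hr, _⟩ := Finset.exists_ne_zero_of_sum_ne_zero h1.ne'
  rw [Finset.mem_filter] at hr
  exact ⟨r, hr.2⟩

/-- For regular strips the Farey sets are nonempty and the sets of rational multiples have a
limiting proportion. -/
theorem RegularStrips.exists_tendsto_nu {l : Filter ℝ} [l.NeBot] {a b : ℝ → ℝ}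
    (h : RegularStrips l a b) (A B : Set ℕ) {q : ℕ} (hq : 0 < q) :
    ∃ c, Tendsto (fun x => nu 1 1 x (a x) (b x) (ratMultiples A B q)) l (𝓝 c) := by
  obtain ⟨c, hc⟩ := h.exists_tendsto A B hq
  -- For `A = B = {1}` and `q = 1` only coprimality remains, so `d` is the limiting share of the
  -- denominator of `nu`; it is at least `1 / 2`, so the quotient of limits makes sense.
  obtain ⟨d, hd⟩ := h.exists_tendsto {1} {1} one_pos
  have hone : ∀ x, mass x (a x) (b x) (pairMultiples {1} {1} 1) =
      mass x (a x) (b x) fun m n => m.Coprime n := fun x =>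
    mass_congr fun m n hm hn => by simp [pairMultiples, multiples, hm, hn]
  have hd2 : 1 / 2 ≤ d := by
    refine ge_of_tendsto hd ?_
    filter_upwards [h.pos] with x hx
    rw [hone, le_div_iff₀ hx]
    linarith [totalMass_le_two_mul_coprime (x := x) (a := a x) (b := b x)]
  refine ⟨c / d, (hc.div hd (by linarith)).congr' ?_⟩
  filter_upwards [h.pos] with x hx
  rw [Pi.div_apply, hone, nu, weightedSum_ratMultiples, weightedSum_fareySet,
    div_div_div_cancel_right₀ hx.ne']

end

theorem theorem5 (lam₁ lam₂ : ℝ → ℝ)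
    (hI : ∀ x : ℝ, 1 ≤ x → 0 ≤ lam₁ x)
    -- the conditions where the left endpoint is zero
    (hzero_tendsto :
      Tendsto (fun x : ℝ => lam₂ x * x) (atTop ⊓ 𝓟 {x : ℝ | lam₁ x = 0}) atTop)
    (hzero_log : ∃ c₁ : ℝ, 0 < c₁ ∧
      ∀ᶠ x : ℝ in atTop, lam₁ x = 0 → Real.log x / Real.log (lam₂ x * x) < c₁)
    -- the conditions where the left endpoint is positive
    (hpos_bounds : ∃ c₂ c₃ : ℝ, 0 < c₂ ∧ 0 < c₃ ∧
      ∀ᶠ x : ℝ in atTop, 0 < lam₁ x →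
        c₂ / Real.log (lam₂ x + 2) < lam₁ x ∧ lam₁ x < lam₂ x ∧ lam₂ x < x ^ c₃)
    (hpos_tendsto :
      Tendsto (fun x : ℝ =>
          1 / Real.log (lam₂ x + 2) * Real.log (lam₂ x / lam₁ x) * Real.log x)
        (atTop ⊓ 𝓟 {x : ℝ | 0 < lam₁ x}) atTop)
    (A B : Set ℕ) (q : ℕ) (hq : 0 < q) :
    (∀ᶠ x : ℝ in atTop, (fareySet x (lam₁ x) (lam₂ x)).Nonempty) ∧
    ∃ l : ℝ, Tendsto (fun x : ℝ => nu 1 1 x (lam₁ x) (lam₂ x) (ratMultiples A B q))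
      atTop (𝓝 l) := by 
  obtain ⟨c₁, _, hlog⟩ := hzero_log
  obtain ⟨c₂, c₃, hc₂, hc₃, hbounds⟩ := hpos_bounds
  have hzero : RegularStrips (atTop ⊓ 𝓟 {x : ℝ | lam₁ x = 0}) lam₁ lam₂ :=
    regularStrips_of_zero inf_le_left (mem_inf_of_right (mem_principal_self _)) hzero_tendsto
      (eventually_inf_principal.2 hlog)
  have hpos : RegularStrips (atTop ⊓ 𝓟 {x : ℝ | 0 < lam₁ x}) lam₁ lam₂ :=
    regularStrips_of_pos inf_le_left hc₂ hc₃
      (eventually_inf_principal.2 (hbounds.mono fun x hx h => ⟨h, hx h⟩)) hpos_tendsto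
  -- The two regimes together cover all large `x`. One of the restricted filters may be trivial;
  -- only their join needs to be proper for the limit.
  have htop : (atTop ⊓ 𝓟 {x : ℝ | lam₁ x = 0}) ⊔ (atTop ⊓ 𝓟 {x : ℝ | 0 < lam₁ x}) = atTop := by
    rw [← inf_sup_left, sup_principal, inf_eq_left, le_principal_iff]
    filter_upwards [eventually_ge_atTop 1] with x hx
    exact (hI x hx).eq_or_lt.imp Eq.symm id
  have h := hzero.sup hpos
  rw [htop] at h
  exact ⟨h.pos.mono fun x hx => fareySet_nonempty_of_totalMass_pos hx,
    h.exists_tendsto_nu A B hq⟩
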